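/- Let $n,p\in\mathbb N$ and consider the single-input bilinear plant with saturated input $$\dot x=Ax+(Bx+b)\,\mathrm{sat}(u)+E,\qquad e=Cx-r,\qquad y=Dx,$$ with state $x\in\mathbb R^n$, input $u\in\mathbb R$, regulated output $e\in\mathbb R$, measured output $y\in\mathbb R^p$, constant reference $r\in\mathbb R$, and constant real matrices $A,B\in\mathbb R^{n\times n}$, $b,E\in\mathbb R^n$, $C\in\mathbb R^{1\times n}$, $D\in\mathbb R^{p\times n}$; here $\mathrm{sat}(s)=\max\{\underline u,\min\{\bar u,s\}\}$ is the saturation onto $\mathcal U=[\underline u,\bar u]$. For $u\in\mathcal U$ put $$F_u=A+uB,\qquad \pi(u)=-F_u^{-1}(bu+E),\qquad g_u=B\pi(u)+b.$$ Assume that for every $u\in\mathcal U$ the matrix $F_u$ is Hurwitz and $CF_u^{-1}g_u\neq0$, and that the pair $(A,D)$ is observable. Suppose that there are a symmetric positive definite $Q\in\mathbb R^{n\times n}$, a matrix $Y\in\mathbb R^{n\times p}$ and numbers $\nu,\epsilon>0$ such that $$\begin{pmatrix} QA+A^\top Q-YD-D^\top Y^\top+(\nu\mu^2+2\epsilon)I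 & Q\\ Q & -\nu I\end{pmatrix}\preceq0,\qquad \mu=|B|\max\{|\underline u|,|\bar u|\},$$ where $|B|$ is the operator norm induced by the Euclidean norm. Let $r\in\mathbb R$, $x_{ss}\in\mathbb R^n$ and $u_{ss}$ in the interior $(\underline u,\bar u)$ of $\mathcal U$ satisfy the regulator equations $$0=(A+Bu_{ss})x_{ss}+bu_{ss}+E,\qquad 0=Cx_{ss}-r.$$ Let $\Upsilon$ be any symmetric positive definite matrix, let $P$ be the solution of $F_{u_{ss}}^\top P+PF_{u_{ss}}=-2\Upsilon$, let $M=CF_{u_{ss}}^{-1}$, and let $L=Q^{-1}Y$. Then, for all $k_p>0$ and $k_i>0$, the equilibrium $(x,z,\hat x)=(x_{ss},0,x_{ss})$ of the closed loop formed by the plant and $$\dot z=e,\qquad \dot{\hat x}=A\hat x+(B\hat x+b)\,\mathrm{sat}(u)+L(y-D\hat x)+E,\qquad u=u_{ss}+\phi(\hat x,z),$$ $$\phi(\hat x,z)=-\big(B(\hat x-x_{ss})+g_{u_{ss}}\big)^\top\Big[k_p(\hat x-x_{ss})^\top P-k_i\big(z-M(\hat x-x_{ss})\big)M\Big]^\top$$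 is globally asymptotically stable and locally exponentially stable (all solutions being defined for all future times). -/

import Mathlib

open Set Filter Topology
open scoped Matrix

noncomputable section

/-- A matrix is Hurwitz when all its complex eigenvalues have negative real part. -/
def IsHurwitz {n : ℕ} (F : Matrix (Fin n) (Fin n) ℝ) : Prop :=
  ∀ z ∈ spectrum ℂ (F.map Complex.ofReal), z.re < 0

/-- Kalman's rank condition: the observability matrix, whose block rows are `D * A ^ k` for
`0 ≤ k < n`, has rank `n`. -/
def IsObservable {n p : ℕ} (A : Matrix (Fin n) (Fin n) ℝ) (D : Matrix (Fin p) (Fin n) ℝ) : Prop :=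
  (Matrix.of fun (q : Fin n × Fin p) (j : Fin n) => (D * A ^ (q.1 : ℕ)) q.2 j).rank = n

/-- The saturation onto the interval `[lo, hi]` (for `lo ≤ hi`). -/
def sat (lo hi s : ℝ) : ℝ := max lo (min hi s)

theorem sat_of_ge {lo hi s : ℝ} (h : lo ≤ hi) (hs : hi ≤ s) : sat lo hi s = hi := by
  simp [sat, min_eq_left hs, h]

theorem sat_of_mem {lo hi s : ℝ} (hs : s ∈ Icc lo hi) : sat lo hi s = s := by
  simp [sat, min_eq_right hs.2, hs.1]

theorem sat_of_le {lo hi s : ℝ} (hs : s ≤ lo) : sat lo hi s = lo := by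
  simp [sat, hs]

/-- The operator norm of a square matrix induced by the Euclidean norm. -/
def spectralNorm2 {n : ℕ} (B : Matrix (Fin n) (Fin n) ℝ) : ℝ :=
  ‖Matrix.toEuclideanCLM (n := Fin n) (𝕜 := ℝ) B‖

/-- The data of the saturated single-input bilinear plant
`x' = A x + (B x + b) sat(u) + E`, `e = C x - r`, `y = D x`, with input range `[lo, hi]`.
The row matrix `C` is stored as a vector. -/
structure BilinearPlant (n p : ℕ) where
  A : Matrix (Fin n) (Fin n) ℝ
  B : Matrix (Fin n) (Fin n) ℝ
  b : Fin n → ℝ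
  E : Fin n → ℝ
  C : Fin n → ℝ
  D : Matrix (Fin p) (Fin n) ℝ
  lo : ℝ
  hi : ℝ

namespace BilinearPlant

variable {n p : ℕ} (S : BilinearPlant n p)

/-- The input range `𝒰 = [lo, hi]`. -/
def inputRange : Set ℝ := Icc S.lo S.hi

/-- `F_u = A + u B`. -/
def F (u : ℝ) : Matrix (Fin n) (Fin n) ℝ := S.A + u • S.B

/-- The steady state `π(u) = - F_u⁻¹ (u b + E)`. -/
def steadyState (u : ℝ) : Fin n → ℝ := -((S.F u)⁻¹ *ᵥ (u • S.b + S.E))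

/-- `g_u = B π(u) + b`. -/
def g (u : ℝ) : Fin n → ℝ := S.B *ᵥ S.steadyState u + S.b

/-- The row vector `M_u = C F_u⁻¹`. -/
def M (u : ℝ) : Fin n → ℝ := S.C ᵥ* (S.F u)⁻¹

/-- For every admissible constant input, the linear dynamics is Hurwitz and the
DC-gain `C F_u⁻¹ g_u` is non-zero. -/
def StandingAssumption : Prop :=
  (∀ u ∈ S.inputRange, IsHurwitz (S.F u)) ∧
    ∀ u ∈ S.inputRange, S.C ⬝ᵥ ((S.F u)⁻¹ *ᵥ S.g u) ≠ 0

/-- The regulator equations `0 = F_u x + b u + E`, `0 = C x - r`. -/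
def RegulatorEquations (r uss : ℝ) (xss : Fin n → ℝ) : Prop :=
  (S.A + uss • S.B) *ᵥ xss + uss • S.b + S.E = 0 ∧ S.C ⬝ᵥ xss - r = 0

/-- The constant `μ = |B| max(|lo|, |hi|)`. -/
def mu : ℝ := spectralNorm2 S.B * max |S.lo| |S.hi|

/-- The matrix of the observer LMI. -/
def observerLMI (Q : Matrix (Fin n) (Fin n) ℝ) (Y : Matrix (Fin n) (Fin p) ℝ) (ν ε : ℝ) :
    Matrix (Fin n ⊕ Fin n) (Fin n ⊕ Fin n) ℝ :=
  Matrix.fromBlocks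
    (Q * S.A + S.Aᵀ * Q - Y * S.D - S.Dᵀ * Yᵀ + (ν * S.mu ^ 2 + 2 * ε) • 1) Q
    Q (-(ν • 1))

/-- The forwarding feedback `φ(x, z)`. -/
def forwardingFeedback (P : Matrix (Fin n) (Fin n) ℝ) (kp ki uss : ℝ) (xss : Fin n → ℝ)
    (x : Fin n → ℝ) (z : ℝ) : ℝ :=
  -((S.B *ᵥ (x - xss) + S.g uss) ⬝ᵥ
    (kp • ((x - xss) ᵥ* P) - (ki * (z - S.M uss ⬝ᵥ (x - xss))) • S.M uss))

/-- The vector field of the closed loop in the variables `(x, z, x̂)`: the plant, the integral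
action `z' = e`, and the Luenberger observer with gain `L`, driven by `u = uss + φ(x̂, z)`. -/
def closedLoop (P : Matrix (Fin n) (Fin n) ℝ) (L : Matrix (Fin n) (Fin p) ℝ)
    (kp ki r uss : ℝ) (xss : Fin n → ℝ) (ξ : (Fin n → ℝ) × ℝ × (Fin n → ℝ)) :
    (Fin n → ℝ) × ℝ × (Fin n → ℝ) :=
  let x := ξ.1
  let z := ξ.2.1
  let xhat := ξ.2.2
  let u := uss + S.forwardingFeedback P kp ki uss xss xhat z
  let y := S.D *ᵥ x
  (S.A *ᵥ x + sat S.lo S.hi u • (S.B *ᵥ x + S.b) + S.E,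
    S.C ⬝ᵥ x - r,
    S.A *ᵥ xhat + sat S.lo S.hi u • (S.B *ᵥ xhat + S.b) + L *ᵥ (y - S.D *ᵥ xhat) + S.E)

end BilinearPlant

section Stability

variable {V : Type*} [NormedAddCommGroup V] [NormedSpace ℝ V]

/-- `x` solves `x' = f(x)` on the time interval `J` (with one-sided derivatives at the ends). -/
def IsSolutionOn (f : V → V) (x : ℝ → V) (J : Set ℝ) : Prop :=
  ∀ t ∈ J, HasDerivWithinAt x (f (x t)) J t

/-- Global asymptotic stability of the equilibrium `xs` of `x' = f(x)`: from every initial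
condition there is a solution on `[0, ∞)`, no solution stops being extendable in finite time,
`xs` is Lyapunov stable, and every solution converges to `xs`.
In finite dimension this does not depend on the choice of the norm. -/
structure IsGloballyAsymptoticallyStable (f : V → V) (xs : V) : Prop where
  equilibrium : f xs = 0
  exists_solution : ∀ ξ : V, ∃ x : ℝ → V, x 0 = ξ ∧ IsSolutionOn f x (Ici 0)
  extendable : ∀ T > 0, ∀ x : ℝ → V, IsSolutionOn f x (Ico 0 T) →
    ∃ y : ℝ → V, IsSolutionOn f y (Ici 0) ∧ EqOn y x (Ico 0 T)
  stable : ∀ ε > 0, ∃ δ > 0, ∀ x : ℝ → V, IsSolutionOn f x (Ici 0) → ‖x 0 - xs‖ < δ →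
    ∀ t ≥ 0, ‖x t - xs‖ < ε
  attractive : ∀ x : ℝ → V, IsSolutionOn f x (Ici 0) → Tendsto x atTop (𝓝 xs)

/-- Local exponential stability of the equilibrium `xs` of `x' = f(x)`: from every initial
condition close to `xs` there is a solution on `[0, ∞)`, and all such solutions converge to `xs`
with a uniform exponential rate. -/
structure IsLocallyExponentiallyStable (f : V → V) (xs : V) : Prop where
  equilibrium : f xs = 0
  decay : ∃ δ > 0, ∃ K > 0, ∃ rate > 0,
    (∀ ξ : V, ‖ξ - xs‖ < δ → ∃ x : ℝ → V, x 0 = ξ ∧ IsSolutionOn f x (Ici 0)) ∧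
    ∀ x : ℝ → V, IsSolutionOn f x (Ici 0) → ‖x 0 - xs‖ < δ →
      ∀ t ≥ 0, ‖x t - xs‖ ≤ K * Real.exp (-(rate * t)) * ‖x 0 - xs‖

end Stability

end

/-! ### Existence, uniqueness and extension of solutions. -/

section Flow

variable {V : Type*} [NormedAddCommGroup V] [NormedSpace ℝ V] {f : V → V}

/-! Write `χ = x̂ - xss`, `e = x - x̂`, `η = z - M χ` and `v = sat(u) - uss`. Since `M F = C`, the
drift `C χ` cancels from `η'`, and the loop becomes a cascade: `e' = (A + sat(u) B - L D) e` drives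
`χ' = F χ + v (B χ + g) + L D e` and `η' = (C - M L D) e - v M (B χ + g)`.

The LMI makes `U = eᵀ Q e` decay exponentially whatever the input in its range
(`observer_dissipation`). For the driven part take `W = kp/2 χᵀ P χ + ki/2 η²`, where `P` is
positive definite by Lyapunov's theorem, proved here through the Cayley transform. The feedback `φ`
is minus the coefficient of `v` in `W'`, so `W' = -ω + (terms bilinear in (χ, η) and e)` with `ω =
kp χᵀ Υ χ + φ v`. Saturation around an interior point preserves sign, hence `φ v ≥ 0`, and the
coupling is at most `c √W √U`.

Two facts finish the argument. First, `W' ≤ c √W √U` with `U` decaying exponentially bounds `W` in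
terms of the initial state only (`one_add_le_of_cascade`). Secondly, on a sublevel set of `W` the
saturation obeys a sector bound `φ v ≥ κ φ²`, and `M g ≠ 0` lets `φ` and `χ` control `η`, so `ω ≥ k
W` there (`exists_le_dissipation`). Then `W + q U` decays exponentially, with constants uniform on
balls of initial states (`CascadeLyapunov.exists_decay`), which gives both kinds of stability.
Global existence holds because the bounded input leaves a vector field of linear growth. -/

theorem IsSolutionOn.mono {x : ℝ → V} {J K : Set ℝ} (h : IsSolutionOn f x J) (hK : K ⊆ J) :
    IsSolutionOn f x K :=
  fun t ht => (h t (hK ht)).mono hK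

theorem IsSolutionOn.continuousOn {x : ℝ → V} {J : Set ℝ} (h : IsSolutionOn f x J) :
    ContinuousOn x J :=
  fun t ht => (h t ht).continuousWithinAt

/-- Two solutions on a compact interval with the same initial value agree, when the vector field is
Lipschitz on balls. -/
theorem IsSolutionOn.eqOn_Icc {T : ℝ} {x y : ℝ → V}
    (hf : ∀ R : ℝ, ∃ K : NNReal, LipschitzOnWith K f (Metric.closedBall 0 R))
    (hx : IsSolutionOn f x (Icc 0 T)) (hy : IsSolutionOn f y (Icc 0 T)) (h0 : x 0 = y 0) :
    EqOn x y (Icc 0 T) := by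
  -- Compactness of the time interval confines both curves to one ball, where a single Lipschitz
  -- constant serves for uniqueness.
  obtain ⟨R₁, hR₁⟩ := isCompact_Icc.exists_bound_of_continuousOn hx.continuousOn
  obtain ⟨R₂, hR₂⟩ := isCompact_Icc.exists_bound_of_continuousOn hy.continuousOn
  obtain ⟨K, hK⟩ := hf (max R₁ R₂)
  have right : ∀ {w : ℝ → V}, IsSolutionOn f w (Icc 0 T) → ∀ t ∈ Ico 0 T,
      HasDerivWithinAt w (f (w t)) (Ici t) t := fun hw t ht =>
    ((hw t (Ico_subset_Icc_self ht)).mono (Icc_subset_Icc_left ht.1)).mono_of_mem_nhdsWithin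
      (Icc_mem_nhdsGE ht.2)
  refine ODE_solution_unique_of_mem_Icc_right (v := fun _ => f)
    (s := fun _ => Metric.closedBall 0 (max R₁ R₂)) (K := K) (fun _ _ => hK)
    hx.continuousOn (right hx) (fun t ht => ?_) hy.continuousOn (right hy) (fun t ht => ?_) h0
  · simpa using Or.inl (hR₁ t (Ico_subset_Icc_self ht))
  · simpa using Or.inr (hR₂ t (Ico_subset_Icc_self ht))

/-- A vector field of linear growth which is Lipschitz on balls has solutions on a time interval
whose length does not depend on the initial value. -/
theorem exists_uniform_step [CompleteSpace V]
    (hf : ∀ R : ℝ, ∃ K : NNReal, LipschitzOnWith K f (Metric.closedBall 0 R))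
    {c : ℝ} (hc : 0 < c) (hgrowth : ∀ ξ, ‖f ξ‖ ≤ c * (1 + ‖ξ‖)) (ξ : V) :
    ∃ x : ℝ → V, x 0 = ξ ∧ IsSolutionOn f x (Icc 0 (1 / (2 * c))) := by
  have hh : 0 < 1 / (2 * c) := by positivity
  -- On the ball of radius `1 + ‖ξ‖` about `ξ` the speed is at most `2c(1 + ‖ξ‖)`; the ratio of
  -- radius to speed is `1/(2c)`, free of `ξ`.
  let a : NNReal := ⟨1 + ‖ξ‖, by positivity⟩
  let L : NNReal := ⟨2 * c * (1 + ‖ξ‖), by positivity⟩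
  obtain ⟨K, hK⟩ := hf (‖ξ‖ + a)
  have hball : ∀ y ∈ Metric.closedBall ξ a, ‖y‖ ≤ ‖ξ‖ + a := fun y hy => by
    have := norm_le_norm_add_norm_sub' y ξ
    rw [mem_closedBall_iff_norm] at hy
    linarith
  have hPL : IsPicardLindelof (fun _ => f) (tmin := 0) (tmax := 1 / (2 * c))
      ⟨0, ⟨le_rfl, hh.le⟩⟩ ξ a 0 L K := by
    refine IsPicardLindelof.of_time_independent (fun y hy => ?_) (hK.mono fun y hy => ?_) ?_
    · refine (hgrowth y).trans ?_
      have h1 := hball y hy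
      change c * (1 + ‖y‖) ≤ 2 * c * (1 + ‖ξ‖)
      have h2 : ‖y‖ ≤ ‖ξ‖ + (1 + ‖ξ‖) := h1
      nlinarith
    · simpa using hball y hy
    · change 2 * c * (1 + ‖ξ‖) * max (1 / (2 * c) - 0) (0 - 0) ≤ (1 + ‖ξ‖) - 0
      rw [sub_zero, sub_zero, max_eq_left hh.le]
      apply le_of_eq
      field_simp
      ring
  exact hPL.exists_eq_forall_mem_Icc_hasDerivWithinAt₀

/-- If the autonomous equation can be solved on a time interval of a fixed positive length from
every initial value, then it can be solved on `[0, ∞)`. -/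
theorem exists_global_of_uniform_step {h : ℝ} (hh : 0 < h)
    (hstep : ∀ ξ, ∃ x : ℝ → V, x 0 = ξ ∧ IsSolutionOn f x (Icc 0 h)) (ξ : V) :
    ∃ x : ℝ → V, x 0 = ξ ∧ IsSolutionOn f x (Ici 0) := by
  choose φ hφ0 hφ using hstep
  let node : ℕ → V := fun k => (fun η => φ η h)^[k] ξ
  have node_succ : ∀ k, node (k + 1) = φ (node k) h := fun k =>
    Function.iterate_succ_apply' _ _ _
  let x : ℝ → V := fun t => φ (node ⌊t / h⌋₊) (t - ⌊t / h⌋₊ * h)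
  have hx : ∀ k : ℕ, EqOn x (fun t => φ (node k) (t - k * h)) (Icc (k * h) ((k + 1 : ℕ) * h)) := by
    intro k t ht
    rcases eq_or_lt_of_le ht.2 with he | hlt
    -- At the right end the floor has already jumped to the next piece; the two formulas agree
    -- because that piece starts at the end value of this one.
    · have : ⌊t / h⌋₊ = k + 1 := by rw [he, mul_div_cancel_right₀ _ hh.ne', Nat.floor_natCast]
      simp only [x, this]
      rw [he, sub_self, hφ0, node_succ]
      congr 1
      push_cast
      ring
    · have : ⌊t / h⌋₊ = k := by
        rw [Nat.floor_eq_iff (div_nonneg ((by positivity : (0 : ℝ) ≤ k * h).trans ht.1) hh.le)]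
        exact ⟨(le_div_iff₀ hh).2 ht.1, (div_lt_iff₀ hh).2 (by exact_mod_cast hlt)⟩
      simp only [x, this]
  have hpiece : ∀ k : ℕ, IsSolutionOn f x (Icc (k * h) ((k + 1 : ℕ) * h)) := by
    intro k t ht
    have hmaps : MapsTo (fun s : ℝ => s - k * h) (Icc (k * h) ((k + 1 : ℕ) * h)) (Icc 0 h) := by
      intro s hs
      have h2 := hs.2
      push_cast at h2
      exact ⟨by linarith [hs.1], by linarith⟩
    have h1 := (hφ (node k) _ (hmaps ht)).scomp t
      ((hasDerivWithinAt_id t (Icc (k * h) ((k + 1 : ℕ) * h))).sub_const (k * h)) hmaps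
    rw [one_smul] at h1
    have h2 : x t = φ (node k) (t - k * h) := hx k ht
    rw [h2]
    exact h1.congr (hx k) h2
  refine ⟨x, by simp [x, node, hφ0], fun t ht => ?_⟩
  have ht0 : (0 : ℝ) ≤ t := ht
  obtain ⟨k, hk⟩ : ∃ k, ⌊t / h⌋₊ = k := ⟨_, rfl⟩
  rw [Nat.floor_eq_iff (div_nonneg ht0 hh.le), le_div_iff₀ hh, div_lt_iff₀ hh] at hk
  have hk2 : t < (k + 1 : ℕ) * h := by exact_mod_cast hk.2
  have hder := hpiece k t ⟨hk.1, hk2.le⟩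
  -- Only a node needs care: at `t = 0` the one-sided derivative suffices, at later nodes the left
  -- and right derivatives agree and are glued.
  rcases eq_or_lt_of_le hk.1 with he | hlt
  · rcases k with _ | j
    · have h0 : t = 0 := by simpa using he.symm
      refine hder.mono_of_mem_nhdsWithin ?_
      subst h0
      simpa using Icc_mem_nhdsGE hh
    · have hj : ((j : ℕ) : ℝ) * h < t := by
        rw [← he]
        push_cast
        linarith
      have hleft := hpiece j t ⟨hj.le, he.ge⟩
      have := hleft.union hder
      rw [Icc_union_Icc_eq_Icc (by push_cast; linarith) (by push_cast; linarith)] at this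
      exact (this.hasDerivAt (Icc_mem_nhds hj hk2)).hasDerivWithinAt
  · exact (hder.hasDerivAt (Icc_mem_nhds hlt hk2)).hasDerivWithinAt

/-- When global solutions exist, every solution on `[0, T)` extends to a global one. -/
theorem exists_extension
    (hf : ∀ R : ℝ, ∃ K : NNReal, LipschitzOnWith K f (Metric.closedBall 0 R))
    (hex : ∀ ξ : V, ∃ x : ℝ → V, x 0 = ξ ∧ IsSolutionOn f x (Ici 0)) {T : ℝ} {x : ℝ → V}
    (hx : IsSolutionOn f x (Ico 0 T)) :
    ∃ y : ℝ → V, IsSolutionOn f y (Ici 0) ∧ EqOn y x (Ico 0 T) := by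
  obtain ⟨y, hy0, hy⟩ := hex (x 0)
  refine ⟨y, hy, fun t ht => ?_⟩
  exact (hy.mono Icc_subset_Ici_self).eqOn_Icc hf (T := t)
    (hx.mono fun s hs => ⟨hs.1, hs.2.trans_lt ht.2⟩) hy0 ⟨ht.1, le_rfl⟩

end Flow

/-! ### Scalar differential inequalities. -/

/-- A function on `[0, ∞)` with nonpositive derivative is bounded by its initial value. -/
theorem le_initial_of_deriv_nonpos {g g' : ℝ → ℝ}
    (hg : ∀ t ≥ 0, HasDerivWithinAt g (g' t) (Ici 0) t) (hg' : ∀ t ≥ 0, g' t ≤ 0)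
    {t : ℝ} (ht : 0 ≤ t) : g t ≤ g 0 := by
  have hanti : AntitoneOn g (Ici 0) := by
    refine antitoneOn_of_hasDerivWithinAt_nonpos (convex_Ici 0)
      (fun s hs => (hg s hs).continuousWithinAt) (f' := g') ?_ ?_
    · intro s hs
      exact (hg s (interior_subset hs)).mono interior_subset
    · exact fun s hs => hg' s (interior_subset hs)
  exact hanti self_mem_Ici ht ht

/-- Grönwall's inequality with a negative rate. -/
theorem le_exp_of_deriv_le {g g' : ℝ → ℝ} {k : ℝ}
    (hg : ∀ t ≥ 0, HasDerivWithinAt g (g' t) (Ici 0) t) (hg' : ∀ t ≥ 0, g' t ≤ -k * g t)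
    {t : ℝ} (ht : 0 ≤ t) : g t ≤ Real.exp (-(k * t)) * g 0 := by
  have h1 : ∀ t ≥ 0, HasDerivWithinAt (fun t => Real.exp (k * t) * g t)
      (Real.exp (k * t) * k * g t + Real.exp (k * t) * g' t) (Ici 0) t := fun t ht => by
    have := ((hasDerivAt_id t).const_mul k).exp.hasDerivWithinAt (s := Ici 0)
    simpa using this.fun_mul (hg t ht)
  have h2 := le_initial_of_deriv_nonpos h1 (fun t ht => by
    have := mul_le_mul_of_nonneg_left (hg' t ht) (Real.exp_pos (k * t)).le
    linarith) ht
  simp only [mul_zero, Real.exp_zero, one_mul] at h2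
  rw [Real.exp_neg, inv_mul_eq_div, le_div_iff₀ (Real.exp_pos _)]
  linarith

/-- A bound on solutions of `w' ≤ c √w √v` when `v` decays exponentially. -/
theorem one_add_le_of_cascade {w w' v : ℝ → ℝ} {a c : ℝ} (ha : 0 < a) (hc : 0 ≤ c)
    (hw0 : ∀ t ≥ 0, 0 ≤ w t)
    (hw : ∀ t ≥ 0, HasDerivWithinAt w (w' t) (Ici 0) t)
    (hw' : ∀ t ≥ 0, w' t ≤ c * Real.sqrt (w t) * Real.sqrt (v t))
    (hv : ∀ t ≥ 0, v t ≤ Real.exp (-(2 * a * t)) * v 0)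
    {t : ℝ} (ht : 0 ≤ t) :
    1 + w t ≤ Real.exp (c * Real.sqrt (v 0) / a) * (1 + w 0) := by
  set α := c * Real.sqrt (v 0) with hα
  have hα0 : 0 ≤ α := by positivity
  have hbound : ∀ t ≥ 0, w' t ≤ α * Real.exp (-(a * t)) * (1 + w t) := by
    intro t ht
    have h1 : Real.sqrt (v t) ≤ Real.exp (-(a * t)) * Real.sqrt (v 0) := by
      have : Real.exp (-(2 * a * t)) = Real.exp (-(a * t)) ^ 2 := by
        rw [← Real.exp_nat_mul]
        congr 1
        push_cast
        ring
      refine (Real.sqrt_le_sqrt (hv t ht)).trans_eq ?_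
      rw [this, Real.sqrt_mul (sq_nonneg _), Real.sqrt_sq (Real.exp_pos _).le]
    -- Replacing `√w` by `1 + w` makes the inequality linear in `1 + w`, with the integrable
    -- coefficient `α exp(-at)`.
    have h2 : Real.sqrt (w t) ≤ 1 + w t := by
      nlinarith [Real.sq_sqrt (hw0 t ht), sq_nonneg (Real.sqrt (w t) - 1)]
    calc w' t ≤ c * Real.sqrt (w t) * Real.sqrt (v t) := hw' t ht
      _ ≤ c * (1 + w t) * (Real.exp (-(a * t)) * Real.sqrt (v 0)) := by
          have := hw0 t ht
          gcongr
      _ = α * Real.exp (-(a * t)) * (1 + w t) := by rw [hα]; ring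
  -- The integrating factor is the exponential of the tail integral `∫_t^∞ α exp(-as) ds = (α/a)
  -- exp(-at)`; it is at least 1 and equals `exp(α/a)` at time 0.
  have hder : ∀ t ≥ 0, HasDerivWithinAt
      (fun t => Real.exp (α / a * Real.exp (-(a * t))) * (1 + w t))
      (Real.exp (α / a * Real.exp (-(a * t))) * (α / a * (Real.exp (-(a * t)) * (-a)))
        * (1 + w t) + Real.exp (α / a * Real.exp (-(a * t))) * w' t) (Ici 0) t := fun t ht => by
    have h1 : HasDerivAt (fun t => -(a * t)) (-a) t := by
      simpa using ((hasDerivAt_id t).const_mul a).fun_neg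
    exact ((h1.exp.const_mul (α / a)).exp.hasDerivWithinAt (s := Ici 0)).mul
      ((hw t ht).const_add 1)
  have h := le_initial_of_deriv_nonpos hder (fun t ht => by
    have h1 := mul_le_mul_of_nonneg_left (hbound t ht)
      (Real.exp_pos (α / a * Real.exp (-(a * t)))).le
    have h2 : α / a * (Real.exp (-(a * t)) * (-a)) = -(α * Real.exp (-(a * t))) := by
      field_simp
    rw [h2]
    linarith) ht
  simp only [mul_zero, neg_zero, Real.exp_zero, mul_one] at h
  refine le_trans ?_ h
  have : 1 ≤ Real.exp (α / a * Real.exp (-(a * t))) := Real.one_le_exp (by positivity)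
  nlinarith [hw0 t ht]

/-! ### From cascade Lyapunov data to stability. -/

section Cascade

variable {V : Type*} [NormedAddCommGroup V] [NormedSpace ℝ V]

/-- Lyapunov data for a cascade: `U` decays exponentially along solutions, and `W` decreases up to
a perturbation driven by `U`. -/
structure CascadeLyapunov (f : V → V) (xs : V) where
  W : V → ℝ
  U : V → ℝ
  dW : V → ℝ
  dU : V → ℝ
  ω : V → ℝ
  a : ℝ
  c : ℝ
  m : ℝ
  m' : ℝ
  a_pos : 0 < a
  c_pos : 0 < c
  m_pos : 0 < m
  m'_pos : 0 < m'
  W_nonneg : ∀ ξ, 0 ≤ W ξ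
  U_nonneg : ∀ ξ, 0 ≤ U ξ
  ω_nonneg : ∀ ξ, 0 ≤ ω ξ
  hasDeriv_W : ∀ x : ℝ → V, IsSolutionOn f x (Ici 0) → ∀ t ≥ 0,
    HasDerivWithinAt (fun t => W (x t)) (dW (x t)) (Ici 0) t
  hasDeriv_U : ∀ x : ℝ → V, IsSolutionOn f x (Ici 0) → ∀ t ≥ 0,
    HasDerivWithinAt (fun t => U (x t)) (dU (x t)) (Ici 0) t
  dU_le : ∀ ξ, dU ξ ≤ -(2 * a) * U ξ
  dW_le : ∀ ξ, dW ξ ≤ -ω ξ + c * Real.sqrt (W ξ) * Real.sqrt (U ξ)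
  -- The constant must depend on `R`: with a bounded input, `φ v` grows only linearly in `η` at `χ =
  -- 0`, while `W` is quadratic.
  le_ω : ∀ R, ∃ k > 0, ∀ ξ, W ξ ≤ R → k * W ξ ≤ ω ξ
  lower : ∀ ξ, ‖ξ - xs‖ ^ 2 ≤ m * (W ξ + U ξ)
  upper : ∀ ξ, W ξ + U ξ ≤ m' * ‖ξ - xs‖ ^ 2

namespace CascadeLyapunov

variable {f : V → V} {xs : V} (D : CascadeLyapunov f xs)
include D

/-- Solutions starting in a given ball decay with a uniform exponential rate. -/
theorem exists_decay (ρ : ℝ) : ∃ K > 0, ∃ rate > 0, ∀ x : ℝ → V,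
    IsSolutionOn f x (Ici 0) → ‖x 0 - xs‖ < ρ →
      ∀ t ≥ 0, ‖x t - xs‖ ≤ K * Real.exp (-(rate * t)) * ‖x 0 - xs‖ := by
  obtain ⟨W, U, dW, dU, ω, a, c, m, m', ha, hc, hm, hm', hW, hU, hω, hdW, hdU, hdUle, hdWle, hωle,
    hlow, hup⟩ := D
  -- The level is the a priori bound of `one_add_le_of_cascade`, with `W` and `U` at time 0 both
  -- replaced by their upper bound `m' ρ²`.
  obtain ⟨k, hk, hkω⟩ := hωle (Real.exp (c * Real.sqrt (m' * ρ ^ 2) / a) * (1 + m' * ρ ^ 2))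
  -- This weight gives `q a = c²/(2k)`, so Young's inequality bounds the coupling by half of the
  -- dissipation `k W` plus half of the decay `2 a q U`.
  set q := c ^ 2 / (2 * a * k) with hq
  have hq0 : 0 < q := by positivity
  set s := min (k / 2) a with hs
  have hs0 : 0 < s := by positivity
  refine ⟨Real.sqrt (m * m' * (1 + q) * (1 + 1 / q)), by positivity, s / 2, by positivity,
    fun x hx hx0 t ht => ?_⟩
  have hinit : W (x 0) + U (x 0) ≤ m' * ρ ^ 2 := (hup (x 0)).trans (by gcongr)
  have hUdecay : ∀ t ≥ 0, U (x t) ≤ Real.exp (-(2 * a * t)) * U (x 0) := fun t ht =>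
    le_exp_of_deriv_le (hdU x hx) (fun t _ => hdUle (x t)) ht
  have hR : ∀ t ≥ 0, k * W (x t) ≤ ω (x t) := by
    intro t ht
    apply hkω
    have h1 := one_add_le_of_cascade ha hc.le (fun t _ => hW (x t)) (hdW x hx)
      (fun t _ => (hdWle (x t)).trans (by linarith [hω (x t)])) hUdecay ht
    have h2 : Real.exp (c * Real.sqrt (U (x 0)) / a) * (1 + W (x 0)) ≤
        Real.exp (c * Real.sqrt (m' * ρ ^ 2) / a) * (1 + m' * ρ ^ 2) := by
      have := hW (x 0)
      have := hU (x 0)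
      gcongr <;> linarith
    linarith
  have hdecay : W (x t) + q * U (x t) ≤ Real.exp (-(s * t)) * (W (x 0) + q * U (x 0)) := by
    refine le_exp_of_deriv_le (g := fun t => W (x t) + q * U (x t))
      (g' := fun t => dW (x t) + q * dU (x t))
      (fun t ht => (hdW x hx t ht).add ((hdU x hx t ht).const_mul q)) (fun t ht => ?_) ht
    have h1 := hdWle (x t)
    have h2 := hdUle (x t)
    have h3 := hR t ht
    have h4 : c * Real.sqrt (W (x t)) * Real.sqrt (U (x t)) ≤
        k / 2 * W (x t) + q * a * U (x t) := by
      have e1 := Real.sq_sqrt (hW (x t))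
      have e2 := Real.sq_sqrt (hU (x t))
      set A := Real.sqrt (W (x t))
      set B := Real.sqrt (U (x t))
      have : k / 2 * A ^ 2 + q * a * B ^ 2 - c * A * B = (k * A - c * B) ^ 2 / (2 * k) := by
        rw [hq]
        field_simp
        ring
      have : 0 ≤ (k * A - c * B) ^ 2 / (2 * k) := by positivity
      rw [← e1, ← e2]
      linarith
    have h5 : s * W (x t) ≤ k / 2 * W (x t) :=
      mul_le_mul_of_nonneg_right (min_le_left _ _) (hW _)
    have h6 : s * (q * U (x t)) ≤ a * (q * U (x t)) :=
      mul_le_mul_of_nonneg_right (min_le_right _ _) (mul_nonneg hq0.le (hU _))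
    have h7 : q * dU (x t) ≤ q * (-(2 * a) * U (x t)) := mul_le_mul_of_nonneg_left h2 hq0.le
    linarith
  have h1 : W (x t) + U (x t) ≤ (1 + 1 / q) * (W (x t) + q * U (x t)) := by
    have : (1 + 1 / q) * (W (x t) + q * U (x t)) =
        W (x t) + U (x t) + (1 / q * W (x t) + q * U (x t)) := by
      field_simp
      ring
    have := mul_nonneg (one_div_pos.2 hq0).le (hW (x t))
    have := mul_nonneg hq0.le (hU (x t))
    linarith
  have h2 : W (x 0) + q * U (x 0) ≤ (1 + q) * (W (x 0) + U (x 0)) := by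
    nlinarith [hW (x 0), hU (x 0)]
  have hexp : Real.exp (-(s * t)) = Real.exp (-(s / 2 * t)) ^ 2 := by
    rw [← Real.exp_nat_mul]
    congr 1
    push_cast
    ring
  refine (sq_le_sq₀ (norm_nonneg _) (by positivity)).1 ?_
  rw [mul_pow, mul_pow, Real.sq_sqrt (by positivity), ← hexp]
  calc ‖x t - xs‖ ^ 2 ≤ m * (W (x t) + U (x t)) := hlow (x t)
    _ ≤ m * ((1 + 1 / q) * (Real.exp (-(s * t)) * ((1 + q) * (m' * ‖x 0 - xs‖ ^ 2)))) := by
        gcongr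
        refine h1.trans ?_
        gcongr
        refine hdecay.trans ?_
        gcongr
        refine h2.trans ?_
        gcongr
        exact hup (x 0)
    _ = m * m' * (1 + q) * (1 + 1 / q) * Real.exp (-(s * t)) * ‖x 0 - xs‖ ^ 2 := by ring

end CascadeLyapunov

/-- A cascade Lyapunov pair, together with global existence, gives both stability properties. -/
theorem CascadeLyapunov.stability [CompleteSpace V] {f : V → V} {xs : V} (D : CascadeLyapunov f xs)
    (hxs : f xs = 0)
    (hf : ∀ R : ℝ, ∃ K : NNReal, LipschitzOnWith K f (Metric.closedBall 0 R))
    {c : ℝ} (hc : 0 < c) (hgrowth : ∀ ξ, ‖f ξ‖ ≤ c * (1 + ‖ξ‖)) :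
    IsGloballyAsymptoticallyStable f xs ∧ IsLocallyExponentiallyStable f xs := by
  have hex : ∀ ξ : V, ∃ x : ℝ → V, x 0 = ξ ∧ IsSolutionOn f x (Ici 0) :=
    exists_global_of_uniform_step (h := 1 / (2 * c)) (by positivity)
      (exists_uniform_step hf hc hgrowth)
  refine ⟨⟨hxs, hex, fun T _ x hx => exists_extension hf hex hx, fun ε hε => ?_, fun x hx => ?_⟩,
    ⟨hxs, 1, one_pos, ?_⟩⟩
  · obtain ⟨K, hK, rate, hrate, h⟩ := D.exists_decay 1
    refine ⟨min 1 (ε / K), by positivity, fun x hx hx0 t ht => ?_⟩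
    have h1 := h x hx (hx0.trans_le (min_le_left _ _)) t ht
    have h2 := hx0.trans_le (min_le_right _ _)
    rw [lt_div_iff₀ hK] at h2
    have h3 : Real.exp (-(rate * t)) ≤ 1 := Real.exp_le_one_iff.2 (by
      have := mul_nonneg hrate.le ht
      linarith)
    calc ‖x t - xs‖ ≤ K * Real.exp (-(rate * t)) * ‖x 0 - xs‖ := h1
      _ ≤ K * 1 * ‖x 0 - xs‖ := by gcongr
      _ < ε := by linarith
  -- The constants may depend on the trajectory, as attractivity asks for no uniformity; the `+ 1`
  -- makes the ball inequality strict.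
  · obtain ⟨K, hK, rate, hrate, h⟩ := D.exists_decay (‖x 0 - xs‖ + 1)
    rw [tendsto_iff_norm_sub_tendsto_zero]
    have hlim : Tendsto (fun t => K * Real.exp (-(rate * t)) * ‖x 0 - xs‖) atTop (𝓝 0) := by
      have : Tendsto (fun t => Real.exp (-(rate * t))) atTop (𝓝 0) :=
        Real.tendsto_exp_neg_atTop_nhds_zero.comp (tendsto_id.const_mul_atTop hrate)
      simpa using (this.const_mul K).mul_const ‖x 0 - xs‖
    refine squeeze_zero' (Eventually.of_forall fun t => norm_nonneg _) ?_ hlim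
    filter_upwards [eventually_ge_atTop 0] with t ht
    exact h x hx (by linarith) t ht
  · obtain ⟨K, hK, rate, hrate, h⟩ := D.exists_decay 1
    exact ⟨K, hK, rate, hrate, fun ξ _ => hex ξ, h⟩

end Cascade

/-! ### Lyapunov's matrix theorem by the Cayley transform. -/

section Lyapunov

/-- Powers of a complex square matrix with spectrum in the open unit disc tend to zero. -/
theorem Matrix.tendsto_pow_of_spectrum_lt_one {n : ℕ} (G : Matrix (Fin n) (Fin n) ℂ)
    (hG : ∀ z ∈ spectrum ℂ G, ‖z‖ < 1) : Tendsto (fun k : ℕ => G ^ k) atTop (𝓝 0) := by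
  rcases n with _ | n
  · exact tendsto_const_nhds.congr fun k => Subsingleton.elim _ _
  let _ : NormedRing (Matrix (Fin (n + 1)) (Fin (n + 1)) ℂ) := Matrix.linftyOpNormedRing
  let _ : NormedAlgebra ℂ (Matrix (Fin (n + 1)) (Fin (n + 1)) ℂ) := Matrix.linftyOpNormedAlgebra
  have : CompleteSpace (Matrix (Fin (n + 1)) (Fin (n + 1)) ℂ) := FiniteDimensional.complete ℂ _
  have hr : spectralRadius ℂ G < 1 := by
    have := spectrum.spectralRadius_lt_of_forall_lt G (r := 1) (fun z hz => by
      simpa [← NNReal.coe_lt_coe] using hG z hz)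
    simpa using this
  obtain ⟨q, hrq, hq1⟩ := exists_between hr
  -- Gelfand's formula: eventually `‖G ^ k‖ ^ (1/k) < q` with `q < 1`.
  have hev := (spectrum.pow_nnnorm_pow_one_div_tendsto_nhds_spectralRadius G).eventually_lt_const hrq
  have hq : Tendsto (fun k : ℕ => q ^ k) atTop (𝓝 0) :=
    ENNReal.tendsto_pow_atTop_nhds_zero_of_lt_one hq1
  refine tendsto_iff_norm_sub_tendsto_zero.2 ?_
  have henn : Tendsto (fun k : ℕ => (‖G ^ k‖₊ : ENNReal)) atTop (𝓝 0) := by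
    refine tendsto_of_tendsto_of_tendsto_of_le_of_le' tendsto_const_nhds hq
      (Eventually.of_forall fun _ => zero_le) ?_
    filter_upwards [hev, eventually_gt_atTop 0] with k hk hk0
    have h1 := ENNReal.rpow_le_rpow hk.le (Nat.cast_nonneg (α := ℝ) k)
    rwa [← ENNReal.rpow_mul, one_div, inv_mul_cancel₀ (by positivity), ENNReal.rpow_one,
      ENNReal.rpow_natCast] at h1
  have := (ENNReal.tendsto_toReal ENNReal.zero_ne_top).comp henn
  simpa [Function.comp_def] using this

variable {n : ℕ} {F : Matrix (Fin n) (Fin n) ℝ}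

theorem IsHurwitz.isUnit_sub (hF : IsHurwitz F) {z : ℂ} (hz : 0 ≤ z.re) :
    IsUnit (z • (1 : Matrix (Fin n) (Fin n) ℂ) - F.map Complex.ofReal) := by
  by_contra h
  have : z ∈ spectrum ℂ (F.map Complex.ofReal) := by
    rwa [spectrum.mem_iff, Algebra.algebraMap_eq_smul_one]
  exact absurd (hF z this) (not_lt.2 hz)

/-- The spectrum is taken over `ℂ` while the inverses are real; the determinant commutes with the
embedding. -/
theorem isUnit_det_of_map {A : Matrix (Fin n) (Fin n) ℝ}
    (h : IsUnit (A.map Complex.ofReal)) : IsUnit A.det := by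
  rw [Matrix.isUnit_iff_isUnit_det] at h
  have : (A.map Complex.ofReal).det = (A.det : ℂ) := (Complex.ofRealHom.map_det A).symm
  rw [this, isUnit_iff_ne_zero] at h
  exact isUnit_iff_ne_zero.2 (by exact_mod_cast h)

theorem IsHurwitz.isUnit_det (hF : IsHurwitz F) : IsUnit F.det := by
  refine isUnit_det_of_map ?_
  simpa using (hF.isUnit_sub (z := 0) le_rfl).neg

theorem IsHurwitz.isUnit_det_one_sub (hF : IsHurwitz F) : IsUnit (1 - F).det := by
  refine isUnit_det_of_map ?_
  have := hF.isUnit_sub (z := 1) (by simp)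
  rwa [one_smul, ← Matrix.map_one Complex.ofReal Complex.ofReal_zero Complex.ofReal_one,
    ← Matrix.map_sub Complex.ofReal Complex.ofReal_sub] at this

/-- The powers of the Cayley transform of a Hurwitz matrix tend to zero. -/
theorem IsHurwitz.tendsto_cayley_pow (hF : IsHurwitz F) :
    Tendsto (fun k : ℕ => ((1 + F) * (1 - F)⁻¹) ^ k) atTop (𝓝 0) := by
  set G := (1 + F) * (1 - F)⁻¹ with hG
  have hGF : G * (1 - F) = 1 + F := by
    rw [hG, Matrix.mul_assoc, Matrix.nonsing_inv_mul _ hF.isUnit_det_one_sub, Matrix.mul_one]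
  set Fc : Matrix (Fin n) (Fin n) ℂ := F.map Complex.ofReal with hFc
  set Gc : Matrix (Fin n) (Fin n) ℂ := G.map Complex.ofReal with hGc
  have hmap : ∀ X : Matrix (Fin n) (Fin n) ℝ, X.map Complex.ofReal =
    Complex.ofRealHom.mapMatrix X := fun _ => rfl
  have hGFc : Gc * (1 - Fc) = 1 + Fc := by
    rw [hGc, hFc, hmap, hmap, ← map_one Complex.ofRealHom.mapMatrix, ← map_sub, ← map_mul, hGF,
      map_add]
  have hspec : ∀ z ∈ spectrum ℂ Gc, ‖z‖ < 1 := by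
    intro z hz
    by_contra hlt
    rw [not_lt] at hlt
    rw [spectrum.mem_iff, Algebra.algebraMap_eq_smul_one] at hz
    apply hz
    -- The Cayley transform pulls `z` back to `(z - 1)/(z + 1)`, which lies in the closed right
    -- half-plane when `|z| ≥ 1`; the point `z = -1` corresponds to infinity and is treated apart.
    have hkey : (z • (1 : Matrix (Fin n) (Fin n) ℂ) - Gc) * (1 - Fc) =
        (z - 1) • (1 : Matrix (Fin n) (Fin n) ℂ) - (z + 1) • Fc := by
      rw [sub_mul, hGFc, smul_mul_assoc, one_mul]
      module
    have hu : IsUnit ((z • (1 : Matrix (Fin n) (Fin n) ℂ) - Gc) * (1 - Fc)) := by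
      rw [hkey]
      by_cases h1 : z + 1 = 0
      · rw [h1, zero_smul, sub_zero, eq_neg_of_add_eq_zero_left h1]
        have : IsUnit ((-1 - 1 : ℂ)) := isUnit_iff_ne_zero.2 (by norm_num)
        simpa [Algebra.algebraMap_eq_smul_one] using
          this.map (algebraMap ℂ (Matrix (Fin n) (Fin n) ℂ))
      · have hre : 0 ≤ ((z - 1) / (z + 1)).re := by
          rw [Complex.div_re, ← add_div]
          refine div_nonneg ?_ (Complex.normSq_nonneg _)
          have : 1 ≤ ‖z‖ ^ 2 := one_le_pow₀ hlt
          rw [Complex.sq_norm, Complex.normSq_apply] at this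
          simp
          nlinarith
        have h2 := hF.isUnit_sub hre
        have h3 : (z - 1) • (1 : Matrix (Fin n) (Fin n) ℂ) - (z + 1) • Fc =
            (z + 1) • (((z - 1) / (z + 1)) • (1 : Matrix (Fin n) (Fin n) ℂ) - Fc) := by
          rw [smul_sub, smul_smul, mul_div_cancel₀ _ h1]
        rw [h3]
        exact h2.smul (Units.mk0 _ h1)
    rw [Matrix.isUnit_iff_isUnit_det, Matrix.det_mul] at hu
    rw [Matrix.isUnit_iff_isUnit_det]
    exact isUnit_of_mul_isUnit_left hu
  have hc := Matrix.tendsto_pow_of_spectrum_lt_one Gc hspec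
  refine tendsto_pi_nhds.2 fun i => tendsto_pi_nhds.2 fun j => ?_
  have h1 := (Complex.continuous_re.tendsto _).comp ((tendsto_pi_nhds.1 ((tendsto_pi_nhds.1 hc) i)) j)
  refine h1.congr fun k => ?_
  have : Gc ^ k = (G ^ k).map Complex.ofReal := by rw [hGc, hmap, hmap, map_pow]
  simp [this]

/-- The Lyapunov equation in terms of the Cayley transform. -/
theorem stein_of_lyapunov (hF : IsHurwitz F) {P N : Matrix (Fin n) (Fin n) ℝ}
    (h : Fᵀ * P + P * F = -((2 : ℝ) • N)) :
    P - ((1 + F) * (1 - F)⁻¹)ᵀ * P * ((1 + F) * (1 - F)⁻¹) =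
      ((1 - F)⁻¹)ᵀ * ((4 : ℝ) • N) * (1 - F)⁻¹ := by
  have hinv : (1 - F) * (1 - F)⁻¹ = 1 := Matrix.mul_nonsing_inv _ hF.isUnit_det_one_sub
  have hinvT : ((1 - F)⁻¹)ᵀ * (1 - F)ᵀ = 1 := by
    rw [← Matrix.transpose_mul, hinv, Matrix.transpose_one]
  have h1 : (1 - F)ᵀ * P * (1 - F) - (1 + F)ᵀ * P * (1 + F) = (4 : ℝ) • N := by
    have : (1 - F)ᵀ * P * (1 - F) - (1 + F)ᵀ * P * (1 + F) = (-2 : ℝ) • (Fᵀ * P + P * F) := by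
      simp only [Matrix.transpose_sub, Matrix.transpose_add, Matrix.transpose_one]
      noncomm_ring
      module
    rw [this, h]
    module
  rw [← h1, Matrix.transpose_mul]
  set J := (1 - F)⁻¹
  calc P - Jᵀ * (1 + F)ᵀ * P * ((1 + F) * J)
      = (Jᵀ * (1 - F)ᵀ) * P * ((1 - F) * J) - Jᵀ * (1 + F)ᵀ * P * ((1 + F) * J) := by
        rw [hinv, hinvT, Matrix.one_mul, Matrix.mul_one]
    _ = Jᵀ * ((1 - F)ᵀ * P * (1 - F) - (1 + F)ᵀ * P * (1 + F)) * J := by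
        noncomm_ring

theorem tendsto_conj_pow {G : Matrix (Fin n) (Fin n) ℝ}
    (hG : Tendsto (fun k : ℕ => G ^ k) atTop (𝓝 0)) (P : Matrix (Fin n) (Fin n) ℝ) :
    Tendsto (fun k : ℕ => (G ^ k)ᵀ * P * G ^ k) atTop (𝓝 0) := by
  have hcont : Continuous fun X : Matrix (Fin n) (Fin n) ℝ => Xᵀ * P * X := by fun_prop
  simpa [Function.comp_def] using (hcont.tendsto 0).comp hG

/-- The solution of a Lyapunov equation with Hurwitz matrix and positive definite right-hand side
is positive definite. -/
theorem IsHurwitz.posDef_of_lyapunov (hF : IsHurwitz F) {P N : Matrix (Fin n) (Fin n) ℝ}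
    (hN : N.PosDef) (h : Fᵀ * P + P * F = -((2 : ℝ) • N)) : P.PosDef := by
  set G := (1 + F) * (1 - F)⁻¹ with hG
  have hlim := hF.tendsto_cayley_pow
  rw [← hG] at hlim
  have hNT : Nᵀ = N := by simpa using hN.isHermitian.eq
  have hsymm : Pᵀ = P := by
    -- The antisymmetric part solves the homogeneous equation, so it is invariant under conjugation
    -- by `G`; the conjugates by `G ^ k` tend to 0, so it vanishes.
    have h0 : Fᵀ * (P - Pᵀ) + (P - Pᵀ) * F = -((2 : ℝ) • (0 : Matrix (Fin n) (Fin n) ℝ)) := by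
      have hT := congrArg Matrix.transpose h
      simp only [Matrix.transpose_add, Matrix.transpose_mul, Matrix.transpose_transpose,
        Matrix.transpose_neg, Matrix.transpose_smul, hNT] at hT
      have : Fᵀ * (P - Pᵀ) + (P - Pᵀ) * F = (Fᵀ * P + P * F) - (Pᵀ * F + Fᵀ * Pᵀ) := by
        noncomm_ring
      rw [this, h, hT]
      simp
    have h1 := stein_of_lyapunov hF h0
    rw [← hG, smul_zero, Matrix.mul_zero, Matrix.zero_mul, sub_eq_zero] at h1
    have h2 : ∀ k : ℕ, (G ^ k)ᵀ * (P - Pᵀ) * G ^ k = P - Pᵀ := by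
      intro k
      induction k with
      | zero => simp
      | succ k ih =>
        rw [pow_succ', Matrix.transpose_mul]
        calc (G ^ k)ᵀ * Gᵀ * (P - Pᵀ) * (G * G ^ k)
            = (G ^ k)ᵀ * (Gᵀ * (P - Pᵀ) * G) * G ^ k := by simp only [Matrix.mul_assoc]
          _ = P - Pᵀ := by rw [← h1, ih]
    have h3 := tendsto_conj_pow hlim (P - Pᵀ)
    simp only [h2] at h3
    have := tendsto_nhds_unique tendsto_const_nhds h3
    exact (sub_eq_zero.1 this).symm
  set J := (1 - F)⁻¹ with hJ
  have hstein := stein_of_lyapunov hF h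
  rw [← hG, ← hJ] at hstein
  have hJinj : ∀ v : Fin n → ℝ, v ≠ 0 → J *ᵥ v ≠ 0 := fun v hv h0 => hv (by
    have := congrArg ((1 - F) *ᵥ ·) h0
    simpa [Matrix.mulVec_mulVec, hJ, Matrix.mul_nonsing_inv _ hF.isUnit_det_one_sub] using this)
  have hquad : ∀ v : Fin n → ℝ, v ⬝ᵥ (P *ᵥ v) - (G *ᵥ v) ⬝ᵥ (P *ᵥ (G *ᵥ v)) =
      4 * ((J *ᵥ v) ⬝ᵥ (N *ᵥ (J *ᵥ v))) := by
    intro v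
    have := congrArg (fun X => v ⬝ᵥ (X *ᵥ v)) hstein
    simp only [Matrix.sub_mulVec, ← Matrix.mulVec_mulVec, dotProduct_sub, Matrix.smul_mulVec,
      Matrix.mulVec_smul, dotProduct_smul, smul_eq_mul, Matrix.dotProduct_mulVec,
      Matrix.vecMul_transpose] at this
    simpa only [Matrix.dotProduct_mulVec] using this
  have hNnn : ∀ w : Fin n → ℝ, 0 ≤ w ⬝ᵥ (N *ᵥ w) := fun w => by
    simpa using hN.posSemidef.dotProduct_mulVec_nonneg w
  refine Matrix.PosDef.of_dotProduct_mulVec_pos (by simpa [Matrix.IsHermitian] using hsymm)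
    fun v hv => ?_
  rw [star_trivial]
  have hNpos : 0 < (J *ᵥ v) ⬝ᵥ (N *ᵥ (J *ᵥ v)) := by
    simpa using hN.dotProduct_mulVec_pos (hJinj v hv)
  -- The comparison is with `G v` and not with `v`: the limit gives a nonnegative form at `G v`, and
  -- the step from `v` to `G v` supplies the strict inequality.
  have hdecr : ∀ k : ℕ, ((G ^ (k + 1)) *ᵥ v) ⬝ᵥ (P *ᵥ ((G ^ (k + 1)) *ᵥ v)) ≤
      (G *ᵥ v) ⬝ᵥ (P *ᵥ (G *ᵥ v)) := by
    intro k
    induction k with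
    | zero => simp
    | succ k ih =>
      have h1 := hquad ((G ^ (k + 1)) *ᵥ v)
      have h2 := hNnn (J *ᵥ ((G ^ (k + 1)) *ᵥ v))
      rw [pow_succ' G (k + 1), ← Matrix.mulVec_mulVec]
      linarith
  have hl : Tendsto (fun k : ℕ => ((G ^ (k + 1)) *ᵥ v) ⬝ᵥ (P *ᵥ ((G ^ (k + 1)) *ᵥ v))) atTop
      (𝓝 0) := by
    have hcont : Continuous fun X : Matrix (Fin n) (Fin n) ℝ => (X *ᵥ v) ⬝ᵥ (P *ᵥ (X *ᵥ v)) := by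
      fun_prop
    simpa [Function.comp_def] using (hcont.tendsto 0).comp (hlim.comp (tendsto_add_atTop_nat 1))
  have h0 := le_of_tendsto' hl hdecr
  have := hquad v
  linarith

end Lyapunov

/-! ### Calculus and norm estimates for matrices and quadratic forms. -/

section MatrixEstimates

variable {n m : ℕ}

theorem HasDerivWithinAt.dotProduct {v w : ℝ → Fin n → ℝ} {v' w' : Fin n → ℝ} {s : Set ℝ} {t : ℝ}
    (hv : HasDerivWithinAt v v' s t) (hw : HasDerivWithinAt w w' s t) :
    HasDerivWithinAt (fun t => v t ⬝ᵥ w t) (v' ⬝ᵥ w t + v t ⬝ᵥ w') s t := by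
  rw [hasDerivWithinAt_pi] at hv hw
  have := HasDerivWithinAt.fun_sum (u := Finset.univ) fun i _ => (hv i).fun_mul (hw i)
  simpa [_root_.dotProduct, Finset.sum_add_distrib] using this

theorem HasDerivWithinAt.matrix_mulVec (A : Matrix (Fin m) (Fin n) ℝ) {v : ℝ → Fin n → ℝ}
    {v' : Fin n → ℝ} {s : Set ℝ} {t : ℝ} (hv : HasDerivWithinAt v v' s t) :
    HasDerivWithinAt (fun t => A *ᵥ v t) (A *ᵥ v') s t :=
  (LinearMap.toContinuousLinearMap A.mulVecLin).hasFDerivAt.comp_hasDerivWithinAt t hv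

theorem ContDiff.matrix_mulVec {V : Type*} [NormedAddCommGroup V] [NormedSpace ℝ V]
    (A : Matrix (Fin m) (Fin n) ℝ) {v : V → Fin n → ℝ} (hv : ContDiff ℝ 1 v) :
    ContDiff ℝ 1 fun ξ => A *ᵥ v ξ :=
  (LinearMap.toContinuousLinearMap A.mulVecLin).contDiff.comp hv

theorem ContDiff.dotProduct {V : Type*} [NormedAddCommGroup V] [NormedSpace ℝ V]
    {v w : V → Fin n → ℝ} (hv : ContDiff ℝ 1 v) (hw : ContDiff ℝ 1 w) :
    ContDiff ℝ 1 fun ξ => v ξ ⬝ᵥ w ξ := by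
  rw [contDiff_pi] at hv hw
  exact ContDiff.sum fun i _ => (hv i).mul (hw i)

theorem Matrix.exists_norm_mulVec_le (A : Matrix (Fin m) (Fin n) ℝ) :
    ∃ C > 0, ∀ v : Fin n → ℝ, ‖A *ᵥ v‖ ≤ C * ‖v‖ := by
  obtain ⟨C, hC, h⟩ := (LinearMap.toContinuousLinearMap A.mulVecLin).bound
  exact ⟨C, hC, h⟩

/-- The norm on `Fin n → ℝ` is the supremum norm, hence the factor `n` where Cauchy–Schwarz would
have none. -/
theorem abs_dotProduct_le (v w : Fin n → ℝ) : |v ⬝ᵥ w| ≤ n * (‖v‖ * ‖w‖) := by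
  refine (Finset.abs_sum_le_sum_abs _ _).trans ?_
  refine (Finset.sum_le_card_nsmul _ _ (‖v‖ * ‖w‖) fun i _ => ?_).trans_eq (by simp)
  rw [abs_mul]
  exact mul_le_mul (norm_le_pi_norm v i) (norm_le_pi_norm w i) (abs_nonneg _) (norm_nonneg _)

theorem Matrix.exists_abs_dotProduct_mulVec_le (A : Matrix (Fin m) (Fin n) ℝ) :
    ∃ C > 0, ∀ (v : Fin m → ℝ) (w : Fin n → ℝ), |v ⬝ᵥ (A *ᵥ w)| ≤ C * (‖v‖ * ‖w‖) := by
  obtain ⟨C, hC, h⟩ := A.exists_norm_mulVec_le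
  refine ⟨m * C + 1, by positivity, fun v w => (abs_dotProduct_le _ _).trans ?_⟩
  have h1 := mul_le_mul_of_nonneg_left (h w) (norm_nonneg v)
  have h2 := mul_le_mul_of_nonneg_left h1 (Nat.cast_nonneg (α := ℝ) m)
  have : 0 ≤ ‖v‖ * ‖w‖ := by positivity
  linarith

theorem exists_abs_dotProduct_le (u : Fin n → ℝ) : ∃ C > 0, ∀ v : Fin n → ℝ, |u ⬝ᵥ v| ≤ C * ‖v‖ := by
  refine ⟨n * ‖u‖ + 1, by positivity, fun v => (abs_dotProduct_le _ _).trans ?_⟩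
  linarith [norm_nonneg v]

/-- A positive definite quadratic form dominates a multiple of the squared norm. -/
theorem Matrix.PosDef.exists_le_dotProduct_mulVec {N : Matrix (Fin n) (Fin n) ℝ} (hN : N.PosDef) :
    ∃ c > 0, ∀ v : Fin n → ℝ, c * ‖v‖ ^ 2 ≤ v ⬝ᵥ (N *ᵥ v) := by
  -- In dimension 0 the unit sphere, on which the form is minimised below, is empty.
  rcases n with _ | n
  · exact ⟨1, one_pos, fun v => by simp [Subsingleton.elim v 0]⟩
  have hcont : Continuous fun v : Fin (n + 1) → ℝ => v ⬝ᵥ (N *ᵥ v) := by fun_prop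
  obtain ⟨v₀, hv₀, hmin⟩ := (isCompact_sphere (0 : Fin (n + 1) → ℝ) 1).exists_isMinOn
    (NormedSpace.sphere_nonempty.2 zero_le_one) hcont.continuousOn
  have hv₀' : v₀ ≠ 0 := by
    rintro rfl
    simp at hv₀
  refine ⟨v₀ ⬝ᵥ (N *ᵥ v₀), by simpa using hN.dotProduct_mulVec_pos hv₀', fun v => ?_⟩
  rcases eq_or_ne v 0 with rfl | hv
  · simp
  have hpos : 0 < ‖v‖ := norm_pos_iff.2 hv
  have h := isMinOn_iff.1 hmin (‖v‖⁻¹ • v) (by simp [norm_smul, hpos.ne'])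
  simp only [Matrix.mulVec_smul, smul_dotProduct, dotProduct_smul, smul_eq_mul] at h
  have h2 := mul_le_mul_of_nonneg_right h (sq_nonneg ‖v‖)
  refine h2.trans_eq ?_
  field_simp

theorem Matrix.dotProduct_mulVec_comm_of_symm {P : Matrix (Fin n) (Fin n) ℝ} (hP : Pᵀ = P)
    (v w : Fin n → ℝ) : v ⬝ᵥ (P *ᵥ w) = w ⬝ᵥ (P *ᵥ v) := by
  rw [Matrix.dotProduct_mulVec, ← Matrix.mulVec_transpose, hP, dotProduct_comm]

/-- `v ⬝ᵥ v` stands for the squared Euclidean norm; the detour through `EuclideanSpace` gives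
exactly the constant that enters `μ`. -/
theorem mulVec_dotProduct_self_le (B : Matrix (Fin n) (Fin n) ℝ) (v : Fin n → ℝ) :
    (B *ᵥ v) ⬝ᵥ (B *ᵥ v) ≤ spectralNorm2 B ^ 2 * (v ⬝ᵥ v) := by
  have hnorm : ∀ w : Fin n → ℝ, w ⬝ᵥ w = ‖WithLp.toLp 2 w‖ ^ 2 := fun w => by
    rw [EuclideanSpace.real_norm_sq_eq]
    exact Finset.sum_congr rfl fun i _ => (sq _).symm
  have h := (Matrix.toEuclideanCLM (n := Fin n) (𝕜 := ℝ) B).le_opNorm (WithLp.toLp 2 v)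
  rw [Matrix.toEuclideanCLM_toLp] at h
  rw [hnorm, hnorm, ← mul_pow]
  exact pow_le_pow_left₀ (norm_nonneg _) h 2

end MatrixEstimates

/-! ### Sector bounds for the saturation. -/

section Saturation

theorem sat_mem_Icc {lo hi : ℝ} (h : lo ≤ hi) (s : ℝ) : sat lo hi s ∈ Icc lo hi :=
  ⟨le_max_left _ _, max_le h (min_le_left _ _)⟩

theorem lipschitzWith_sat (lo hi : ℝ) : LipschitzWith 1 (sat lo hi) :=
  (LipschitzWith.id.const_min hi).const_max lo

theorem abs_le_of_mem_Icc {lo hi s : ℝ} (hs : s ∈ Icc lo hi) : |s| ≤ max |lo| |hi| :=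
  abs_le_max_abs_abs hs.1 hs.2

/-- The saturation centred at an interior point satisfies a sector condition on bounded sets. -/
theorem exists_sector_sat {lo hi u : ℝ} (hu : u ∈ Ioo lo hi) (Φ : ℝ) :
    ∃ κ > 0, ∀ s, |s| ≤ Φ → κ * s ^ 2 ≤ s * (sat lo hi (u + s) - u) := by
  -- Without saturation the ratio of output to `s` is 1; under saturation the output is at least `δ`
  -- in size while `|s| ≤ Φ`. The `+ 1` keeps the denominator positive.
  set δ := min (hi - u) (u - lo) with hδ
  have hδ0 : 0 < δ := lt_min (sub_pos.2 hu.2) (sub_pos.2 hu.1)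
  refine ⟨min 1 (δ / (|Φ| + 1)), by positivity, fun s hs => ?_⟩
  set κ := min 1 (δ / (|Φ| + 1))
  have hκ0 : 0 < κ := by positivity
  have hκ1 : κ ≤ 1 := min_le_left _ _
  have hκs : κ * |s| ≤ δ := by
    have h1 : κ ≤ δ / (|Φ| + 1) := min_le_right _ _
    rw [le_div_iff₀ (by positivity)] at h1
    have : |s| ≤ |Φ| + 1 := by linarith [le_abs_self Φ]
    nlinarith
  rcases le_total hi (u + s) with h | h
  · rw [sat_of_ge (hu.1.trans hu.2).le h]
    have hs0 : 0 < s := by linarith [hu.2]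
    rw [abs_of_pos hs0] at hκs
    have : κ * s ≤ hi - u := hκs.trans (min_le_left _ _)
    nlinarith
  · rcases le_total (u + s) lo with h' | h'
    · rw [sat_of_le h']
      have hs0 : s < 0 := by linarith [hu.1]
      rw [abs_of_neg hs0] at hκs
      have : κ * -s ≤ u - lo := hκs.trans (min_le_right _ _)
      nlinarith
    · rw [sat_of_mem ⟨h', h⟩]
      nlinarith [sq_nonneg s]

theorem mul_sat_sub_nonneg {lo hi u : ℝ} (hu : u ∈ Ioo lo hi) (s : ℝ) :
    0 ≤ s * (sat lo hi (u + s) - u) := by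
  obtain ⟨κ, hκ, h⟩ := exists_sector_sat hu |s|
  exact (by positivity : 0 ≤ κ * s ^ 2).trans (h s le_rfl)

end Saturation

/-! ### Deviation dynamics and derivatives of the Lyapunov functions. -/

namespace BilinearPlant

variable {n p : ℕ} (S : BilinearPlant n p)

/-- The dissipation inequality of the observer error encoded in the LMI. -/
theorem observer_dissipation {Q : Matrix (Fin n) (Fin n) ℝ} {Y : Matrix (Fin n) (Fin p) ℝ}
    {ν ε : ℝ} (hQ : Q.PosDef) (hν : 0 < ν) (hLMI : (-(S.observerLMI Q Y ν ε)).PosSemidef)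
    {u : ℝ} (hu : u ∈ Icc S.lo S.hi) (v : Fin n → ℝ) :
    v ⬝ᵥ (Q *ᵥ (S.A *ᵥ v + u • (S.B *ᵥ v) - (Q⁻¹ * Y) *ᵥ (S.D *ᵥ v))) ≤ -ε * (v ⬝ᵥ v) := by
  have hQT : Qᵀ = Q := by simpa using hQ.isHermitian.eq
  have hQdet : IsUnit Q.det := isUnit_iff_ne_zero.2 hQ.det_pos.ne'
  -- The bilinear term is treated as a perturbation known only through `|w| ≤ μ |v|`. The LMI is
  -- tested on `(v, w)`, where `-ν |w|²` and `ν μ² |v|²` offset each other.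
  set w := u • (S.B *ᵥ v) with hw
  have h := hLMI.dotProduct_mulVec_nonneg (Sum.elim v w)
  have hBw : w ⬝ᵥ w ≤ S.mu ^ 2 * (v ⬝ᵥ v) := by
    have h1 := mulVec_dotProduct_self_le S.B v
    have h2 : u ^ 2 ≤ max |S.lo| |S.hi| ^ 2 := sq_le_sq' (by
      have := abs_le_of_mem_Icc hu; linarith [neg_abs_le u]) ((le_abs_self u).trans
        (abs_le_of_mem_Icc hu))
    have h3 : 0 ≤ v ⬝ᵥ v := by simpa using dotProduct_star_self_nonneg v
    have h4 : 0 ≤ (S.B *ᵥ v) ⬝ᵥ (S.B *ᵥ v) := by simpa using dotProduct_star_self_nonneg (S.B *ᵥ v)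
    simp only [hw, smul_dotProduct, dotProduct_smul, smul_eq_mul, mu]
    calc u * (u * ((S.B *ᵥ v) ⬝ᵥ (S.B *ᵥ v))) = u ^ 2 * ((S.B *ᵥ v) ⬝ᵥ (S.B *ᵥ v)) := by ring
      _ ≤ max |S.lo| |S.hi| ^ 2 * (spectralNorm2 S.B ^ 2 * (v ⬝ᵥ v)) := by gcongr
      _ = _ := by ring
  have e1 : v ⬝ᵥ ((S.Aᵀ * Q) *ᵥ v) = v ⬝ᵥ ((Q * S.A) *ᵥ v) := by
    have := Matrix.transpose_mul Q S.A
    rw [hQT] at this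
    rw [← this, Matrix.mulVec_transpose, dotProduct_comm, ← Matrix.dotProduct_mulVec]
  have e2 : v ⬝ᵥ ((S.Dᵀ * Yᵀ) *ᵥ v) = v ⬝ᵥ ((Y * S.D) *ᵥ v) := by
    rw [← Matrix.transpose_mul, Matrix.mulVec_transpose, dotProduct_comm,
      ← Matrix.dotProduct_mulVec]
  have e3 : w ⬝ᵥ (Q *ᵥ v) = v ⬝ᵥ (Q *ᵥ w) := Matrix.dotProduct_mulVec_comm_of_symm hQT _ _
  have e4 : Q *ᵥ ((Q⁻¹ * Y) *ᵥ (S.D *ᵥ v)) = (Y * S.D) *ᵥ v := by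
    rw [Matrix.mulVec_mulVec, Matrix.mulVec_mulVec, ← Matrix.mul_assoc,
      Matrix.mul_nonsing_inv _ hQdet, Matrix.one_mul]
  simp only [observerLMI, star_trivial, Matrix.neg_mulVec, Matrix.fromBlocks_mulVec,
    dotProduct_neg, sumElim_dotProduct_sumElim, Sum.elim_comp_inl, Sum.elim_comp_inr,
    Matrix.add_mulVec, Matrix.sub_mulVec, dotProduct_add, dotProduct_sub, Matrix.smul_mulVec,
    Matrix.one_mulVec, dotProduct_smul, smul_eq_mul, e1, e2, e3] at h
  rw [Matrix.mulVec_sub, Matrix.mulVec_add, e4, dotProduct_sub, dotProduct_add,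
    Matrix.mulVec_mulVec v Q S.A]
  have h5 := mul_le_mul_of_nonneg_left hBw hν.le
  linarith

variable {P : Matrix (Fin n) (Fin n) ℝ} {kp ki r uss : ℝ} {xss : Fin n → ℝ}

/-- The deviation of the integral state from the graph of the forwarding map. -/
noncomputable def forwardingError (uss : ℝ) (xss : Fin n → ℝ) (ξ : (Fin n → ℝ) × ℝ × (Fin n → ℝ)) : ℝ :=
  ξ.2.1 - S.M uss ⬝ᵥ (ξ.2.2 - xss)

/-- The deviation of the saturated input from its steady-state value. -/
noncomputable def inputDeviation (P : Matrix (Fin n) (Fin n) ℝ) (kp ki uss : ℝ) (xss : Fin n → ℝ)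
    (ξ : (Fin n → ℝ) × ℝ × (Fin n → ℝ)) : ℝ :=
  sat S.lo S.hi (uss + S.forwardingFeedback P kp ki uss xss ξ.2.2 ξ.2.1) - uss

/-- The Lyapunov function of the state feedback loop, evaluated at the estimated state. -/
noncomputable def forwardingLyapunov (P : Matrix (Fin n) (Fin n) ℝ) (kp ki uss : ℝ) (xss : Fin n → ℝ)
    (ξ : (Fin n → ℝ) × ℝ × (Fin n → ℝ)) : ℝ :=
  kp / 2 * ((ξ.2.2 - xss) ⬝ᵥ (P *ᵥ (ξ.2.2 - xss))) + ki / 2 * S.forwardingError uss xss ξ ^ 2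

/-- Invertibility of `F` makes the steady state unique, so `g` is `B xss + b`, the input vector of
the deviation dynamics. -/
theorem steadyState_eq (hF : IsHurwitz (S.F uss)) (hreg : S.RegulatorEquations r uss xss) :
    S.steadyState uss = xss := by
  have h : S.F uss *ᵥ xss + (uss • S.b + S.E) = 0 := by
    rw [← add_assoc]
    exact hreg.1
  rw [steadyState, ← neg_eq_of_add_eq_zero_right h, Matrix.mulVec_neg, neg_neg,
    Matrix.mulVec_mulVec, Matrix.nonsing_inv_mul _ hF.isUnit_det, Matrix.one_mulVec]

/-- The Sylvester equation of forwarding: `M χ` reproduces the drift `C χ` of the integrator, which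
therefore disappears from the dynamics of `z - M χ`. -/
theorem M_vecMul_F (hF : IsHurwitz (S.F uss)) : S.M uss ᵥ* S.F uss = S.C := by
  rw [M, Matrix.vecMul_vecMul, Matrix.nonsing_inv_mul _ hF.isUnit_det, Matrix.vecMul_one]

variable {L : Matrix (Fin n) (Fin p) ℝ}

/-- The dynamics of the estimated state in deviation coordinates. -/
theorem closedLoop_estimate (hF : IsHurwitz (S.F uss)) (hreg : S.RegulatorEquations r uss xss)
    (ξ : (Fin n → ℝ) × ℝ × (Fin n → ℝ)) :
    (S.closedLoop P L kp ki r uss xss ξ).2.2 = S.F uss *ᵥ (ξ.2.2 - xss) +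
      S.inputDeviation P kp ki uss xss ξ • (S.B *ᵥ (ξ.2.2 - xss) + S.g uss) +
      L *ᵥ (S.D *ᵥ (ξ.1 - ξ.2.2)) := by
  have h := hreg.1
  have h' : S.A *ᵥ xss = -(uss • (S.B *ᵥ xss)) - uss • S.b - S.E := by
    rw [Matrix.add_mulVec, Matrix.smul_mulVec] at h
    rw [← sub_eq_zero, ← h]
    abel
  simp only [closedLoop, inputDeviation, g, S.steadyState_eq hF hreg, F, Matrix.add_mulVec,
    Matrix.smul_mulVec, Matrix.mulVec_sub, h']
  module

/-- The dynamics of the observer error. -/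
theorem closedLoop_error (ξ : (Fin n → ℝ) × ℝ × (Fin n → ℝ)) :
    (S.closedLoop P L kp ki r uss xss ξ).1 - (S.closedLoop P L kp ki r uss xss ξ).2.2 =
      S.A *ᵥ (ξ.1 - ξ.2.2) +
        sat S.lo S.hi (uss + S.forwardingFeedback P kp ki uss xss ξ.2.2 ξ.2.1) •
          (S.B *ᵥ (ξ.1 - ξ.2.2)) - L *ᵥ (S.D *ᵥ (ξ.1 - ξ.2.2)) := by
  simp only [closedLoop, Matrix.mulVec_sub]
  module

/-- The dynamics of the forwarding error. -/
theorem closedLoop_forwardingError (hF : IsHurwitz (S.F uss))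
    (hreg : S.RegulatorEquations r uss xss) (ξ : (Fin n → ℝ) × ℝ × (Fin n → ℝ)) :
    (S.closedLoop P L kp ki r uss xss ξ).2.1 -
        S.M uss ⬝ᵥ (S.closedLoop P L kp ki r uss xss ξ).2.2 =
      S.C ⬝ᵥ (ξ.1 - ξ.2.2) - S.M uss ⬝ᵥ (L *ᵥ (S.D *ᵥ (ξ.1 - ξ.2.2))) -
        S.inputDeviation P kp ki uss xss ξ *
          (S.M uss ⬝ᵥ (S.B *ᵥ (ξ.2.2 - xss) + S.g uss)) := by
  rw [S.closedLoop_estimate hF hreg, dotProduct_add, dotProduct_add, Matrix.dotProduct_mulVec,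
    S.M_vecMul_F hF, dotProduct_smul, smul_eq_mul]
  have h1 : (S.closedLoop P L kp ki r uss xss ξ).2.1 = S.C ⬝ᵥ ξ.1 - r := rfl
  have h2 := hreg.2
  rw [h1]
  simp only [dotProduct_sub]
  linarith

/-- In this form `φ` is visibly minus the coefficient of the input deviation in the derivative of
`W`, so the input contributes `-φ v`. -/
theorem forwardingFeedback_eq (ξ : (Fin n → ℝ) × ℝ × (Fin n → ℝ)) :
    S.forwardingFeedback P kp ki uss xss ξ.2.2 ξ.2.1 =
      -(kp * ((ξ.2.2 - xss) ⬝ᵥ (P *ᵥ (S.B *ᵥ (ξ.2.2 - xss) + S.g uss))) -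
        ki * S.forwardingError uss xss ξ *
          (S.M uss ⬝ᵥ (S.B *ᵥ (ξ.2.2 - xss) + S.g uss))) := by
  rw [forwardingFeedback, dotProduct_comm, sub_dotProduct, smul_dotProduct, smul_dotProduct,
    smul_eq_mul, smul_eq_mul, ← Matrix.dotProduct_mulVec]
  rfl

/-- The derivative of the Lyapunov function along the closed loop. -/
theorem forwardingLyapunov_deriv (hF : IsHurwitz (S.F uss))
    (hreg : S.RegulatorEquations r uss xss) {N : Matrix (Fin n) (Fin n) ℝ} (hPT : Pᵀ = P)
    (hP : (S.F uss)ᵀ * P + P * S.F uss = -((2 : ℝ) • N))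
    {x : ℝ → (Fin n → ℝ) × ℝ × (Fin n → ℝ)} {s : Set ℝ} {t : ℝ}
    (hx : HasDerivWithinAt x (S.closedLoop P L kp ki r uss xss (x t)) s t) :
    HasDerivWithinAt (fun t => S.forwardingLyapunov P kp ki uss xss (x t))
      (-(kp * (((x t).2.2 - xss) ⬝ᵥ (N *ᵥ ((x t).2.2 - xss))) +
          S.forwardingFeedback P kp ki uss xss (x t).2.2 (x t).2.1 *
            S.inputDeviation P kp ki uss xss (x t)) +
        (kp * (((x t).2.2 - xss) ⬝ᵥ ((P * (L * S.D)) *ᵥ ((x t).1 - (x t).2.2))) +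
          ki * S.forwardingError uss xss (x t) *
            ((S.C - S.M uss ᵥ* (L * S.D)) ⬝ᵥ ((x t).1 - (x t).2.2)))) s t := by
  have hz : HasDerivWithinAt (fun t => (x t).2.1) _ s t :=
    ((ContinuousLinearMap.fst ℝ ℝ (Fin n → ℝ)).comp
      (ContinuousLinearMap.snd ℝ (Fin n → ℝ) (ℝ × (Fin n → ℝ)))).hasFDerivAt.comp_hasDerivWithinAt
        t hx
  have hχ : HasDerivWithinAt (fun t => (x t).2.2 - xss) _ s t :=
    (((ContinuousLinearMap.snd ℝ ℝ (Fin n → ℝ)).comp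
      (ContinuousLinearMap.snd ℝ (Fin n → ℝ) (ℝ × (Fin n → ℝ)))).hasFDerivAt.comp_hasDerivWithinAt
        t hx).sub_const xss
  have hη := hz.fun_sub ((hasDerivWithinAt_const t s (S.M uss)).dotProduct hχ)
  have hW := ((hχ.dotProduct (hχ.matrix_mulVec P)).const_mul (kp / 2)).fun_add
    ((hη.fun_pow 2).const_mul (ki / 2))
  refine hW.congr_deriv ?_
  simp only [ContinuousLinearMap.comp_apply, ContinuousLinearMap.coe_fst',
    ContinuousLinearMap.coe_snd', zero_dotProduct, zero_add]
  rw [S.closedLoop_forwardingError hF hreg, S.closedLoop_estimate hF hreg]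
  have hη' : (x t).2.1 - S.M uss ⬝ᵥ ((x t).2.2 - xss) = S.forwardingError uss xss (x t) := rfl
  rw [hη']
  have hφ := S.forwardingFeedback_eq (P := P) (kp := kp) (ki := ki) (uss := uss) (xss := xss) (x t)
  set χ := (x t).2.2 - xss
  set e := (x t).1 - (x t).2.2
  set η := S.forwardingError uss xss (x t)
  set v := S.inputDeviation P kp ki uss xss (x t)
  set w := S.B *ᵥ χ + S.g uss
  have hlyap : χ ⬝ᵥ (P *ᵥ (S.F uss *ᵥ χ)) = -(χ ⬝ᵥ (N *ᵥ χ)) := by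
    have h1 := congrArg (fun X => χ ⬝ᵥ (X *ᵥ χ)) hP
    have h2 : χ ⬝ᵥ ((S.F uss)ᵀ *ᵥ (P *ᵥ χ)) = χ ⬝ᵥ (P *ᵥ (S.F uss *ᵥ χ)) := by
      rw [Matrix.mulVec_transpose, dotProduct_comm,
        ← Matrix.dotProduct_mulVec]
      exact (dotProduct_comm _ _).trans (Matrix.dotProduct_mulVec_comm_of_symm hPT _ _)
    simp only [Matrix.add_mulVec, dotProduct_add, ← Matrix.mulVec_mulVec, h2, Matrix.neg_mulVec,
      Matrix.smul_mulVec, dotProduct_neg, dotProduct_smul, smul_eq_mul] at h1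
    linarith
  rw [Matrix.dotProduct_mulVec_comm_of_symm hPT _ χ, hφ]
  simp only [Matrix.mulVec_add, Matrix.mulVec_smul, dotProduct_add, dotProduct_smul, smul_eq_mul,
    hlyap, sub_dotProduct, ← Matrix.dotProduct_mulVec, ← Matrix.mulVec_mulVec]
  ring

/-- The derivative of the quadratic form of the observer error along the closed loop. -/
theorem errorForm_deriv {Q : Matrix (Fin n) (Fin n) ℝ} (hQT : Qᵀ = Q)
    {x : ℝ → (Fin n → ℝ) × ℝ × (Fin n → ℝ)} {s : Set ℝ} {t : ℝ}
    (hx : HasDerivWithinAt x (S.closedLoop P L kp ki r uss xss (x t)) s t) :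
    HasDerivWithinAt (fun t => ((x t).1 - (x t).2.2) ⬝ᵥ (Q *ᵥ ((x t).1 - (x t).2.2)))
      (2 * (((x t).1 - (x t).2.2) ⬝ᵥ (Q *ᵥ (S.A *ᵥ ((x t).1 - (x t).2.2) +
        sat S.lo S.hi (uss + S.forwardingFeedback P kp ki uss xss (x t).2.2 (x t).2.1) •
          (S.B *ᵥ ((x t).1 - (x t).2.2)) - L *ᵥ (S.D *ᵥ ((x t).1 - (x t).2.2)))))) s t := by
  have he : HasDerivWithinAt (fun t => (x t).1 - (x t).2.2) _ s t :=
    ((ContinuousLinearMap.fst ℝ (Fin n → ℝ) (ℝ × (Fin n → ℝ))) -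
      ((ContinuousLinearMap.snd ℝ ℝ (Fin n → ℝ)).comp
        (ContinuousLinearMap.snd ℝ (Fin n → ℝ) (ℝ × (Fin n → ℝ))))).hasFDerivAt.comp_hasDerivWithinAt
        t hx
  refine (he.dotProduct (he.matrix_mulVec Q)).congr_deriv ?_
  simp only [_root_.sub_apply, ContinuousLinearMap.comp_apply,
    ContinuousLinearMap.coe_fst', ContinuousLinearMap.coe_snd']
  rw [Matrix.dotProduct_mulVec_comm_of_symm hQT _ ((x t).1 - (x t).2.2), S.closedLoop_error]
  ring

/-! ### Regularity and growth of the closed-loop vector field. -/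

theorem contDiff_forwardingFeedback :
    ContDiff ℝ 1 fun ξ : (Fin n → ℝ) × ℝ × (Fin n → ℝ) =>
      S.forwardingFeedback P kp ki uss xss ξ.2.2 ξ.2.1 := by
  have hxh : ContDiff ℝ 1 fun ξ : (Fin n → ℝ) × ℝ × (Fin n → ℝ) => ξ.2.2 - xss :=
    by fun_prop
  have hz : ContDiff ℝ 1 fun ξ : (Fin n → ℝ) × ℝ × (Fin n → ℝ) => ξ.2.1 :=
    by fun_prop
  simp only [forwardingFeedback, ← Matrix.mulVec_transpose]
  have h1 : ContDiff ℝ 1 fun ξ : (Fin n → ℝ) × ℝ × (Fin n → ℝ) =>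
        S.B *ᵥ (ξ.2.2 - xss) + S.g uss := (hxh.matrix_mulVec S.B).add contDiff_const
  have h2 : ContDiff ℝ 1 fun ξ : (Fin n → ℝ) × ℝ × (Fin n → ℝ) =>
        kp • (Pᵀ *ᵥ (ξ.2.2 - xss)) := (hxh.matrix_mulVec Pᵀ).const_smul kp
  have h3 : ContDiff ℝ 1 fun ξ : (Fin n → ℝ) × ℝ × (Fin n → ℝ) =>
        ki * (ξ.2.1 - S.M uss ⬝ᵥ (ξ.2.2 - xss)) :=
      contDiff_const.mul (hz.sub ((contDiff_const (c := S.M uss)).dotProduct hxh))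
  have h4 : ContDiff ℝ 1 fun ξ : (Fin n → ℝ) × ℝ × (Fin n → ℝ) =>
        (ki * (ξ.2.1 - S.M uss ⬝ᵥ (ξ.2.2 - xss))) • S.M uss := h3.smul contDiff_const
  exact (h1.dotProduct (h2.sub h4)).neg

/-- The closed-loop vector field is Lipschitz on balls. -/
theorem exists_lipschitzOnWith_closedLoop (R : ℝ) :
    ∃ K : NNReal, LipschitzOnWith K (S.closedLoop P L kp ki r uss xss)
      (Metric.closedBall 0 R) := by
  -- The value of the saturation is made an independent variable `q.2`: the field is a smooth map
  -- composed with `ξ ↦ (ξ, sat(u))`, which is only locally Lipschitz.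
  have hx : ContDiff ℝ 1 fun q : ((Fin n → ℝ) × ℝ × (Fin n → ℝ)) × ℝ => q.1.1 :=
    by fun_prop
  have hxhat : ContDiff ℝ 1 fun q : ((Fin n → ℝ) × ℝ × (Fin n → ℝ)) × ℝ => q.1.2.2 :=
    by fun_prop
  have hs : ContDiff ℝ 1 fun q : ((Fin n → ℝ) × ℝ × (Fin n → ℝ)) × ℝ => q.2 := contDiff_snd
  have hplant : ∀ w : ((Fin n → ℝ) × ℝ × (Fin n → ℝ)) × ℝ → Fin n → ℝ, ContDiff ℝ 1 w →
      ContDiff ℝ 1 fun q => S.A *ᵥ w q + q.2 • (S.B *ᵥ w q + S.b) := fun w hw =>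
    (hw.matrix_mulVec S.A).add (hs.smul ((hw.matrix_mulVec S.B).add contDiff_const))
  have hinj : ContDiff ℝ 1 fun q : ((Fin n → ℝ) × ℝ × (Fin n → ℝ)) × ℝ =>
      L *ᵥ (S.D *ᵥ q.1.1 - S.D *ᵥ q.1.2.2) :=
    ((hx.matrix_mulVec S.D).sub (hxhat.matrix_mulVec S.D)).matrix_mulVec L
  have hout : ContDiff ℝ 1 fun q : ((Fin n → ℝ) × ℝ × (Fin n → ℝ)) × ℝ => S.C ⬝ᵥ q.1.1 - r :=
    (contDiff_const.dotProduct hx).sub contDiff_const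
  have hG := ((hplant _ hx).add (contDiff_const (c := S.E))).prodMk
    (hout.prodMk (((hplant _ hxhat).add hinj).add (contDiff_const (c := S.E))))
  have hu : LocallyLipschitz fun ξ : (Fin n → ℝ) × ℝ × (Fin n → ℝ) =>
      uss + S.forwardingFeedback P kp ki uss xss ξ.2.2 ξ.2.1 :=
    (contDiff_const.add S.contDiff_forwardingFeedback).locallyLipschitz
  have hinner := (LocallyLipschitz.id (α := (Fin n → ℝ) × ℝ × (Fin n → ℝ))).prodMk
    ((lipschitzWith_sat S.lo S.hi).locallyLipschitz.comp hu)
  have hloc := hG.locallyLipschitz.comp hinner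
  have hlip := hloc.locallyLipschitzOn (s := Metric.closedBall 0 R)
  exact hlip.exists_lipschitzOnWith_of_compact (isCompact_closedBall 0 R)

/-- The closed-loop vector field has linear growth, the input being bounded. -/
theorem exists_closedLoop_growth (hlohi : S.lo ≤ S.hi) :
    ∃ c > 0, ∀ ξ, ‖S.closedLoop P L kp ki r uss xss ξ‖ ≤ c * (1 + ‖ξ‖) := by
  obtain ⟨cA, hcA, hA⟩ := S.A.exists_norm_mulVec_le
  obtain ⟨cB, hcB, hB⟩ := S.B.exists_norm_mulVec_le
  obtain ⟨cD, hcD, hD⟩ := S.D.exists_norm_mulVec_le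
  obtain ⟨cL, hcL, hL⟩ := L.exists_norm_mulVec_le
  obtain ⟨cC, hcC, hC⟩ := exists_abs_dotProduct_le S.C
  set U := max |S.lo| |S.hi| with hU
  have hU0 : 0 ≤ U := (abs_nonneg _).trans (le_max_left _ _)
  have hplant : ∀ (s : ℝ) (x : Fin n → ℝ), ‖S.A *ᵥ x + sat S.lo S.hi s • (S.B *ᵥ x + S.b)‖ ≤
      cA * ‖x‖ + U * (cB * ‖x‖ + ‖S.b‖) := by
    intro s x
    refine (norm_add_le _ _).trans (add_le_add (hA x) ?_)
    rw [norm_smul]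
    exact mul_le_mul (abs_le_of_mem_Icc (sat_mem_Icc hlohi s))
      ((norm_add_le _ _).trans (add_le_add (hB x) le_rfl)) (norm_nonneg _) hU0
  refine ⟨cA + U * (cB + ‖S.b‖) + 2 * (cL * cD) + ‖S.E‖ + cC + |r|, by positivity, fun ξ => ?_⟩
  have hξ := norm_nonneg ξ
  have h1 : ‖ξ.1‖ ≤ ‖ξ‖ := norm_fst_le ξ
  have h2 : ‖ξ.2.2‖ ≤ ‖ξ‖ := (norm_snd_le ξ.2).trans (norm_snd_le ξ)
  have hmono : ∀ {y : ℝ}, y ≤ ‖ξ‖ → cA * y + U * (cB * y + ‖S.b‖) ≤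
      cA * ‖ξ‖ + U * (cB * ‖ξ‖ + ‖S.b‖) := fun hy => by gcongr
  have hexp : (cA + U * (cB + ‖S.b‖) + 2 * (cL * cD) + ‖S.E‖ + cC + |r|) * (1 + ‖ξ‖) =
      (cA * ‖ξ‖ + U * (cB * ‖ξ‖ + ‖S.b‖)) + 2 * (cL * cD) * ‖ξ‖ + ‖S.E‖ + (cC * ‖ξ‖ + |r|) +
      (cA + U * cB + U * ‖S.b‖ * ‖ξ‖ + 2 * (cL * cD) + ‖S.E‖ * ‖ξ‖ + cC + |r| * ‖ξ‖) := by ring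
  have hrest : 0 ≤ cA + U * cB + U * ‖S.b‖ * ‖ξ‖ + 2 * (cL * cD) + ‖S.E‖ * ‖ξ‖ + cC + |r| * ‖ξ‖ := by
    positivity
  have hmain : 0 ≤ cA * ‖ξ‖ + U * (cB * ‖ξ‖ + ‖S.b‖) := by positivity
  have hC0 : 0 ≤ cC * ‖ξ‖ + |r| := by positivity
  have hLD0 : 0 ≤ 2 * (cL * cD) * ‖ξ‖ := by positivity
  have hE0 := norm_nonneg S.E
  rw [hexp]
  refine norm_prod_le_iff.2 ⟨?_, norm_prod_le_iff.2 ⟨?_, ?_⟩⟩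
  · have := (norm_add_le _ S.E).trans (add_le_add
      ((hplant (uss + S.forwardingFeedback P kp ki uss xss ξ.2.2 ξ.2.1) ξ.1).trans (hmono h1)) le_rfl)
    refine this.trans ?_
    linarith
  · have : ‖S.C ⬝ᵥ ξ.1 - r‖ ≤ cC * ‖ξ‖ + |r| := by
      refine (norm_sub_le _ _).trans (add_le_add ((hC ξ.1).trans ?_) le_rfl)
      gcongr
    refine this.trans ?_
    linarith
  · have hLD : ‖L *ᵥ (S.D *ᵥ ξ.1 - S.D *ᵥ ξ.2.2)‖ ≤ 2 * (cL * cD) * ‖ξ‖ := by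
      refine (hL _).trans ?_
      have h3 : ‖S.D *ᵥ ξ.1 - S.D *ᵥ ξ.2.2‖ ≤ cD * ‖ξ‖ + cD * ‖ξ‖ :=
        (norm_sub_le _ _).trans (add_le_add ((hD _).trans (by gcongr)) ((hD _).trans (by gcongr)))
      calc cL * ‖S.D *ᵥ ξ.1 - S.D *ᵥ ξ.2.2‖ ≤ cL * (cD * ‖ξ‖ + cD * ‖ξ‖) := by gcongr
        _ = _ := by ring
    have := (norm_add_le _ S.E).trans (add_le_add ((norm_add_le _ _).trans (add_le_add
      ((hplant (uss + S.forwardingFeedback P kp ki uss xss ξ.2.2 ξ.2.1) ξ.2.2).trans (hmono h2))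
      hLD)) le_rfl)
    refine this.trans ?_
    linarith

end BilinearPlant

/-! ### Comparison of the Lyapunov function, its dissipation and the norm. -/

namespace BilinearPlant

variable {n p : ℕ} (S : BilinearPlant n p)
  {P : Matrix (Fin n) (Fin n) ℝ} {kp ki r uss : ℝ} {xss : Fin n → ℝ}

/-- In the coordinates `(χ, η)` the function is a block-diagonal positive definite quadratic form.
-/
theorem exists_forwardingLyapunov_bounds (hP : P.PosDef) (hkp : 0 < kp) (hki : 0 < ki) :
    ∃ w₀ > 0, ∃ w₁ > 0, ∀ ξ,
      w₀ * (‖ξ.2.2 - xss‖ ^ 2 + S.forwardingError uss xss ξ ^ 2) ≤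
        S.forwardingLyapunov P kp ki uss xss ξ ∧
      S.forwardingLyapunov P kp ki uss xss ξ ≤
        w₁ * (‖ξ.2.2 - xss‖ ^ 2 + S.forwardingError uss xss ξ ^ 2) := by
  obtain ⟨p₀, hp₀, hlow⟩ := hP.exists_le_dotProduct_mulVec
  obtain ⟨p₁, hp₁, hup⟩ := P.exists_abs_dotProduct_mulVec_le
  refine ⟨min (kp / 2 * p₀) (ki / 2), by positivity, kp / 2 * p₁ + ki / 2, by positivity,
    fun ξ => ?_⟩
  have h1 := mul_le_mul_of_nonneg_left (hlow (ξ.2.2 - xss)) (half_pos hkp).le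
  have h2 := mul_le_mul_of_nonneg_left ((le_abs_self _).trans (hup (ξ.2.2 - xss) (ξ.2.2 - xss)))
    (half_pos hkp).le
  have hη := sq_nonneg (S.forwardingError uss xss ξ)
  have hχ := sq_nonneg ‖ξ.2.2 - xss‖
  rw [forwardingLyapunov]
  constructor
  · rw [mul_add]
    have h3 := mul_le_mul_of_nonneg_right (min_le_left (kp / 2 * p₀) (ki / 2)) hχ
    have h4 := mul_le_mul_of_nonneg_right (min_le_right (kp / 2 * p₀) (ki / 2)) hη
    linarith
  · have h3 : 0 ≤ kp / 2 * p₁ * S.forwardingError uss xss ξ ^ 2 := by positivity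
    have h4 : 0 ≤ ki / 2 * ‖ξ.2.2 - xss‖ ^ 2 := by positivity
    linarith

/-- On sublevel sets, the nominal dissipation dominates a multiple of the Lyapunov function. -/
theorem exists_le_dissipation (hP : P.PosDef) {N : Matrix (Fin n) (Fin n) ℝ} (hN : N.PosDef)
    (hkp : 0 < kp) (hki : 0 < ki) (huss : uss ∈ Ioo S.lo S.hi) (hg : S.M uss ⬝ᵥ S.g uss ≠ 0)
    (R : ℝ) :
    ∃ k > 0, ∀ ξ, S.forwardingLyapunov P kp ki uss xss ξ ≤ R →
      k * S.forwardingLyapunov P kp ki uss xss ξ ≤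
        kp * ((ξ.2.2 - xss) ⬝ᵥ (N *ᵥ (ξ.2.2 - xss))) +
          S.forwardingFeedback P kp ki uss xss ξ.2.2 ξ.2.1 *
            S.inputDeviation P kp ki uss xss ξ := by
  obtain ⟨w₀, hw₀, w₁, hw₁, hW⟩ :=
    S.exists_forwardingLyapunov_bounds (uss := uss) (xss := xss) hP hkp hki
  obtain ⟨ν₀, hν₀, hNlow⟩ := hN.exists_le_dotProduct_mulVec
  obtain ⟨cP, hcP, hPup⟩ := P.exists_abs_dotProduct_mulVec_le
  obtain ⟨cB, hcB, hB⟩ := S.B.exists_norm_mulVec_le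
  obtain ⟨cM, hcM, hM⟩ := exists_abs_dotProduct_le (S.M uss)
  -- On the sublevel set `ρ` bounds `‖χ‖` and `|η|`, and `β` bounds `‖B χ + g‖`; the sector constant
  -- `κ` is then taken for the resulting bound on `|φ|`.
  set ρ := Real.sqrt (R / w₀) with hρ
  have hρ0 : 0 ≤ ρ := Real.sqrt_nonneg _
  set β := cB * ρ + ‖S.g uss‖ with hβ
  have hβ0 : 0 ≤ β := by positivity
  obtain ⟨κ, hκ, hsector⟩ := exists_sector_sat huss (kp * (cP * (ρ * β)) + ki * ρ * (cM * β))
  -- `φ` differs from `ki (M g) η` by at most `τ ‖χ‖`. As `M g ≠ 0`, `Γ > 0` and `η²` is controlled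
  -- by `φ²` and `‖χ‖²`.
  set τ := kp * (cP * β) + ki * ρ * (cM * cB) with hτ
  set Γ := (ki * (S.M uss ⬝ᵥ S.g uss)) ^ 2 with hΓ
  have hΓ0 : 0 < Γ := by
    have := mul_ne_zero hki.ne' hg
    positivity
  -- Both conditions come from inserting the bound on `η²` into `k (‖χ‖² + η²)`: the coefficient of
  -- `‖χ‖²` must not exceed `kp ν₀`, that of `φ²` must not exceed `κ`.
  set k := min (kp * ν₀ / (1 + 2 * τ ^ 2 / Γ)) (κ * Γ / 2) with hk
  have hk0 : 0 < k := by positivity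
  refine ⟨k / w₁, by positivity, fun ξ hξ => ?_⟩
  have hWξ := hW ξ
  have hφ := S.forwardingFeedback_eq (P := P) (kp := kp) (ki := ki) (uss := uss) (xss := xss) ξ
  have hN' := hNlow (ξ.2.2 - xss)
  have hv : S.inputDeviation P kp ki uss xss ξ =
    sat S.lo S.hi (uss + S.forwardingFeedback P kp ki uss xss ξ.2.2 ξ.2.1) - uss := rfl
  rw [hv]
  set χ := ξ.2.2 - xss
  set η := S.forwardingError uss xss ξ
  set φ := S.forwardingFeedback P kp ki uss xss ξ.2.2 ξ.2.1
  have hsum : ‖χ‖ ^ 2 + η ^ 2 ≤ R / w₀ := by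
    rw [le_div_iff₀ hw₀]
    linarith [hWξ.1]
  have hχρ : ‖χ‖ ≤ ρ := Real.le_sqrt_of_sq_le (by linarith [sq_nonneg η])
  have hηρ : |η| ≤ ρ := Real.abs_le_sqrt (by linarith [sq_nonneg ‖χ‖])
  have hw : ‖S.B *ᵥ χ + S.g uss‖ ≤ β := by
    refine (norm_add_le _ _).trans ?_
    have := (hB χ).trans (mul_le_mul_of_nonneg_left hχρ hcB.le)
    linarith
  have hPw : |χ ⬝ᵥ (P *ᵥ (S.B *ᵥ χ + S.g uss))| ≤ cP * (‖χ‖ * β) :=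
    (hPup _ _).trans (by gcongr)
  have hMw : |S.M uss ⬝ᵥ (S.B *ᵥ χ + S.g uss)| ≤ cM * β := (hM _).trans (by gcongr)
  have hMB : |S.M uss ⬝ᵥ (S.B *ᵥ χ)| ≤ cM * (cB * ‖χ‖) :=
    (hM _).trans (by gcongr; exact hB χ)
  have hφbound : |φ| ≤ kp * (cP * (ρ * β)) + ki * ρ * (cM * β) := by
    rw [hφ, abs_neg]
    refine (abs_sub _ _).trans ?_
    rw [abs_mul, abs_mul, abs_mul, abs_of_pos hkp, abs_of_pos hki]
    have h1 : |χ ⬝ᵥ (P *ᵥ (S.B *ᵥ χ + S.g uss))| ≤ cP * (ρ * β) := hPw.trans (by gcongr)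
    gcongr
  have hηbound : |ki * (S.M uss ⬝ᵥ S.g uss) * η| ≤ |φ| + τ * ‖χ‖ := by
    have h1 : ki * (S.M uss ⬝ᵥ S.g uss) * η = φ +
        (kp * (χ ⬝ᵥ (P *ᵥ (S.B *ᵥ χ + S.g uss))) - ki * η * (S.M uss ⬝ᵥ (S.B *ᵥ χ))) := by
      rw [hφ, dotProduct_add (S.M uss)]
      ring
    rw [h1]
    refine (abs_add_le _ _).trans (add_le_add le_rfl ((abs_sub _ _).trans ?_))
    rw [abs_mul, abs_mul, abs_mul, abs_of_pos hkp, abs_of_pos hki]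
    calc kp * |χ ⬝ᵥ (P *ᵥ (S.B *ᵥ χ + S.g uss))| + ki * |η| * |S.M uss ⬝ᵥ (S.B *ᵥ χ)|
        ≤ kp * (cP * (‖χ‖ * β)) + ki * ρ * (cM * (cB * ‖χ‖)) := by gcongr
      _ = τ * ‖χ‖ := by rw [hτ]; ring
  have hη2 : Γ * η ^ 2 ≤ 2 * φ ^ 2 + 2 * τ ^ 2 * ‖χ‖ ^ 2 := by
    have h1 := pow_le_pow_left₀ (abs_nonneg _) hηbound 2
    rw [sq_abs, mul_pow] at h1
    have h2 : (|φ| + τ * ‖χ‖) ^ 2 ≤ 2 * |φ| ^ 2 + 2 * (τ * ‖χ‖) ^ 2 := by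
      linarith [sq_nonneg (|φ| - τ * ‖χ‖)]
    rw [sq_abs, mul_pow] at h2
    linarith
  have hκφ := hsector φ hφbound
  have hk1 : k * (1 + 2 * τ ^ 2 / Γ) ≤ kp * ν₀ :=
    (le_div_iff₀ (by positivity)).1 (min_le_left _ _)
  have hk2 : k * (2 / Γ) ≤ κ := by
    have : k ≤ κ * Γ / 2 := min_le_right _ _
    calc k * (2 / Γ) ≤ κ * Γ / 2 * (2 / Γ) := by gcongr
      _ = κ := by field_simp
  have hη3 : η ^ 2 ≤ 2 / Γ * φ ^ 2 + 2 * τ ^ 2 / Γ * ‖χ‖ ^ 2 := by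
    have : 2 / Γ * φ ^ 2 + 2 * τ ^ 2 / Γ * ‖χ‖ ^ 2 =
        (2 * φ ^ 2 + 2 * τ ^ 2 * ‖χ‖ ^ 2) / Γ := by ring
    rw [this, le_div_iff₀ hΓ0]
    linarith
  calc k / w₁ * S.forwardingLyapunov P kp ki uss xss ξ
      ≤ k / w₁ * (w₁ * (‖χ‖ ^ 2 + η ^ 2)) := by gcongr; exact hWξ.2
    _ = k * (‖χ‖ ^ 2 + η ^ 2) := by field_simp
    _ ≤ k * (‖χ‖ ^ 2 + (2 / Γ * φ ^ 2 + 2 * τ ^ 2 / Γ * ‖χ‖ ^ 2)) := by gcongr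
    _ = k * (1 + 2 * τ ^ 2 / Γ) * ‖χ‖ ^ 2 + k * (2 / Γ) * φ ^ 2 := by ring
    _ ≤ kp * ν₀ * ‖χ‖ ^ 2 + κ * φ ^ 2 := by gcongr
    _ ≤ _ := by
        have := mul_le_mul_of_nonneg_left hN' hkp.le
        linarith

/-- The deviation from the equilibrium is equivalent to the deviation in the coordinates given by
the estimated state, the forwarding error and the observer error. -/
theorem exists_deviation_bounds (uss : ℝ) (xss : Fin n → ℝ) :
    ∃ c > 0, ∀ ξ : (Fin n → ℝ) × ℝ × (Fin n → ℝ),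
      ‖ξ - (xss, 0, xss)‖ ^ 2 ≤
        c * (‖ξ.2.2 - xss‖ ^ 2 + S.forwardingError uss xss ξ ^ 2 + ‖ξ.1 - ξ.2.2‖ ^ 2) ∧
      ‖ξ.2.2 - xss‖ ^ 2 + S.forwardingError uss xss ξ ^ 2 + ‖ξ.1 - ξ.2.2‖ ^ 2 ≤
        c * ‖ξ - (xss, 0, xss)‖ ^ 2 := by
  obtain ⟨cM, hcM, hM⟩ := exists_abs_dotProduct_le (S.M uss)
  -- The change of coordinates is triangular. One direction costs `3 (1 + cM)²`, the other `1 + (1 +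
  -- cM)² + 4`; the constant covers both.
  refine ⟨3 * (1 + cM) ^ 2 + 5, by positivity, fun ξ => ?_⟩
  have hMχ := hM (ξ.2.2 - xss)
  have hη : S.forwardingError uss xss ξ = ξ.2.1 - S.M uss ⬝ᵥ (ξ.2.2 - xss) := rfl
  have hd1 : ‖ξ.1 - xss‖ ≤ ‖ξ - (xss, 0, xss)‖ := norm_fst_le (ξ - (xss, 0, xss))
  have hd2 : |ξ.2.1| ≤ ‖ξ - (xss, 0, xss)‖ := by
    have h : ‖ξ.2.1 - 0‖ ≤ ‖ξ - (xss, 0, xss)‖ :=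
      (norm_fst_le (ξ - (xss, 0, xss)).2).trans (norm_snd_le _)
    rwa [sub_zero] at h
  have hd3 : ‖ξ.2.2 - xss‖ ≤ ‖ξ - (xss, 0, xss)‖ :=
    (norm_snd_le (ξ - (xss, 0, xss)).2).trans (norm_snd_le _)
  have hmax : ‖ξ - (xss, 0, xss)‖ ≤ max ‖ξ.1 - xss‖ (max |ξ.2.1| ‖ξ.2.2 - xss‖) := by
    simp [Prod.norm_def]
  have he1 : ‖ξ.1 - xss‖ ≤ ‖ξ.1 - ξ.2.2‖ + ‖ξ.2.2 - xss‖ := norm_sub_le_norm_sub_add_norm_sub _ _ _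
  have he2 : ‖ξ.1 - ξ.2.2‖ ≤ ‖ξ.1 - xss‖ + ‖ξ.2.2 - xss‖ := by
    rw [norm_sub_rev ξ.2.2]
    exact norm_sub_le_norm_sub_add_norm_sub _ _ _
  have hη1 : |ξ.2.1| ≤ |S.forwardingError uss xss ξ| + cM * ‖ξ.2.2 - xss‖ := by
    have : ξ.2.1 = S.forwardingError uss xss ξ + S.M uss ⬝ᵥ (ξ.2.2 - xss) := by rw [hη]; ring
    rw [this]
    exact (abs_add_le _ _).trans (add_le_add le_rfl hMχ)
  have hη2 : |S.forwardingError uss xss ξ| ≤ |ξ.2.1| + cM * ‖ξ.2.2 - xss‖ := by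
    rw [hη]
    exact (abs_sub _ _).trans (add_le_add le_rfl hMχ)
  rw [← sq_abs (S.forwardingError uss xss ξ)]
  have hd0 := norm_nonneg (ξ - (xss, 0, xss))
  set d := ‖ξ - (xss, 0, xss)‖
  have ha := norm_nonneg (ξ.2.2 - xss)
  have hb := abs_nonneg (S.forwardingError uss xss ξ)
  have hc := norm_nonneg (ξ.1 - ξ.2.2)
  set a := ‖ξ.2.2 - xss‖
  set b := |S.forwardingError uss xss ξ|
  set e := ‖ξ.1 - ξ.2.2‖
  constructor
  · have h1 : d ≤ (1 + cM) * (a + b + e) := by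
      have hx : 0 ≤ cM * (b + e) := by positivity
      have hy : 0 ≤ cM * a := by positivity
      refine hmax.trans (max_le ?_ (max_le ?_ ?_)) <;> linarith
    calc d ^ 2 ≤ ((1 + cM) * (a + b + e)) ^ 2 := pow_le_pow_left₀ hd0 h1 2
      _ = (1 + cM) ^ 2 * (a + b + e) ^ 2 := by ring
      _ ≤ (1 + cM) ^ 2 * (3 * (a ^ 2 + b ^ 2 + e ^ 2)) := by
          gcongr
          linarith [sq_nonneg (a - b), sq_nonneg (b - e), sq_nonneg (a - e)]
      _ = 3 * (1 + cM) ^ 2 * (a ^ 2 + b ^ 2 + e ^ 2) := by ring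
      _ ≤ _ := by
          gcongr
          linarith
  · have hb' : b ≤ (1 + cM) * d := by
      have := mul_le_mul_of_nonneg_left hd3 hcM.le
      linarith
    have he' : e ≤ 2 * d := by linarith
    have h1 := pow_le_pow_left₀ ha hd3 2
    have h2 := pow_le_pow_left₀ hb hb' 2
    have h3 := pow_le_pow_left₀ hc he' 2
    have h4 : 0 ≤ (1 + cM) ^ 2 * d ^ 2 := by positivity
    rw [mul_pow] at h2 h3
    linarith

end BilinearPlant

/-! ### Assembly of the cascade and the theorem. -/

namespace BilinearPlant

variable {n p : ℕ} (S : BilinearPlant n p)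

/-- The cascade Lyapunov data of the closed loop. -/
theorem nonempty_cascadeLyapunov {Q : Matrix (Fin n) (Fin n) ℝ} {Y : Matrix (Fin n) (Fin p) ℝ}
    {ν ε : ℝ} (hQ : Q.PosDef) (hν : 0 < ν) (hε : 0 < ε)
    (hLMI : (-(S.observerLMI Q Y ν ε)).PosSemidef) {r uss : ℝ} {xss : Fin n → ℝ}
    (huss : uss ∈ Ioo S.lo S.hi) (hreg : S.RegulatorEquations r uss xss)
    (hF : IsHurwitz (S.F uss)) (hg : S.M uss ⬝ᵥ S.g uss ≠ 0)
    {N P : Matrix (Fin n) (Fin n) ℝ} (hN : N.PosDef)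
    (hlyap : (S.F uss)ᵀ * P + P * S.F uss = -((2 : ℝ) • N))
    {kp ki : ℝ} (hkp : 0 < kp) (hki : 0 < ki) :
    Nonempty (CascadeLyapunov (S.closedLoop P (Q⁻¹ * Y) kp ki r uss xss) (xss, 0, xss)) := by
  have hP : P.PosDef := hF.posDef_of_lyapunov hN hlyap
  have hPT : Pᵀ = P := by simpa using hP.isHermitian.eq
  have hQT : Qᵀ = Q := by simpa using hQ.isHermitian.eq
  obtain ⟨w₀, hw₀, w₁, hw₁, hW⟩ :=
    S.exists_forwardingLyapunov_bounds (uss := uss) (xss := xss) hP hkp hki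
  obtain ⟨q₀, hq₀, hQlow⟩ := hQ.exists_le_dotProduct_mulVec
  obtain ⟨q₁, hq₁, hQup'⟩ := Q.exists_abs_dotProduct_mulVec_le
  have hQup : ∀ v, v ⬝ᵥ (Q *ᵥ v) ≤ q₁ * ‖v‖ ^ 2 := fun v => by
    rw [sq]
    exact (le_abs_self _).trans (hQup' v v)
  obtain ⟨i₀, hi₀, hI⟩ :=
    (Matrix.PosDef.one (n := Fin n) (R := ℝ)).exists_le_dotProduct_mulVec
  simp only [Matrix.one_mulVec] at hI
  obtain ⟨d, hd, hdev⟩ := S.exists_deviation_bounds uss xss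
  obtain ⟨c₁, hc₁, hX⟩ := (P * (Q⁻¹ * Y * S.D)).exists_abs_dotProduct_mulVec_le
  obtain ⟨c₂, hc₂, hC⟩ := exists_abs_dotProduct_le (S.C - S.M uss ᵥ* (Q⁻¹ * Y * S.D))
  have hQnn : ∀ v, 0 ≤ v ⬝ᵥ (Q *ᵥ v) := fun v =>
    (by positivity : 0 ≤ q₀ * ‖v‖ ^ 2).trans (hQlow v)
  have hWnn : ∀ ξ, 0 ≤ S.forwardingLyapunov P kp ki uss xss ξ := fun ξ =>
    (by positivity : 0 ≤ w₀ * (‖ξ.2.2 - xss‖ ^ 2 + S.forwardingError uss xss ξ ^ 2)).trans (hW ξ).1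
  have hNnn : ∀ v, 0 ≤ v ⬝ᵥ (N *ᵥ v) := fun v => by
    simpa using hN.posSemidef.dotProduct_mulVec_nonneg v
  refine ⟨{
    W := S.forwardingLyapunov P kp ki uss xss
    U := fun ξ => (ξ.1 - ξ.2.2) ⬝ᵥ (Q *ᵥ (ξ.1 - ξ.2.2))
    dW := fun ξ =>
      -(kp * ((ξ.2.2 - xss) ⬝ᵥ (N *ᵥ (ξ.2.2 - xss))) +
          S.forwardingFeedback P kp ki uss xss ξ.2.2 ξ.2.1 *
            S.inputDeviation P kp ki uss xss ξ) +
        (kp * ((ξ.2.2 - xss) ⬝ᵥ ((P * (Q⁻¹ * Y * S.D)) *ᵥ (ξ.1 - ξ.2.2))) +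
          ki * S.forwardingError uss xss ξ *
            ((S.C - S.M uss ᵥ* (Q⁻¹ * Y * S.D)) ⬝ᵥ (ξ.1 - ξ.2.2)))
    dU := fun ξ => 2 * ((ξ.1 - ξ.2.2) ⬝ᵥ (Q *ᵥ (S.A *ᵥ (ξ.1 - ξ.2.2) +
        sat S.lo S.hi (uss + S.forwardingFeedback P kp ki uss xss ξ.2.2 ξ.2.1) •
          (S.B *ᵥ (ξ.1 - ξ.2.2)) - (Q⁻¹ * Y) *ᵥ (S.D *ᵥ (ξ.1 - ξ.2.2)))))
    ω := fun ξ => kp * ((ξ.2.2 - xss) ⬝ᵥ (N *ᵥ (ξ.2.2 - xss))) +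
          S.forwardingFeedback P kp ki uss xss ξ.2.2 ξ.2.1 *
            S.inputDeviation P kp ki uss xss ξ
    -- `i₀` compares the Euclidean form in the dissipation with the supremum norm, and `q₁` compares
    -- that norm with `U`.
    a := ε * i₀ / q₁
    -- Both coupling terms are products of `‖χ‖` or `|η|`, at most `√W / √w₀`, with `‖e‖`, at most
    -- `√U / √q₀`.
    c := (kp * c₁ + ki * c₂) / (Real.sqrt w₀ * Real.sqrt q₀)
    m := d * (1 / w₀ + 1 / q₀)
    m' := (w₁ + q₁) * d
    a_pos := by positivity
    c_pos := by positivity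
    m_pos := by positivity
    m'_pos := by positivity
    W_nonneg := hWnn
    U_nonneg := fun ξ => hQnn _
    ω_nonneg := fun ξ => add_nonneg (mul_nonneg hkp.le (hNnn _)) (mul_sat_sub_nonneg huss _)
    hasDeriv_W := fun x hx t ht => S.forwardingLyapunov_deriv hF hreg hPT hlyap (hx t ht)
    hasDeriv_U := fun x hx t ht => S.errorForm_deriv hQT (hx t ht)
    dU_le := fun ξ => ?_
    dW_le := fun ξ => ?_
    le_ω := S.exists_le_dissipation hP hN hkp hki huss hg
    lower := fun ξ => ?_
    upper := fun ξ => ?_ }⟩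
  · have h1 := S.observer_dissipation hQ hν hLMI (sat_mem_Icc (huss.1.trans huss.2).le
      (uss + S.forwardingFeedback P kp ki uss xss ξ.2.2 ξ.2.1)) (ξ.1 - ξ.2.2)
    have h2 := mul_le_mul_of_nonneg_left (hI (ξ.1 - ξ.2.2)) hε.le
    have h3 : ε * i₀ / q₁ * ((ξ.1 - ξ.2.2) ⬝ᵥ (Q *ᵥ (ξ.1 - ξ.2.2))) ≤
        ε * (i₀ * ‖ξ.1 - ξ.2.2‖ ^ 2) := by
      calc _ ≤ ε * i₀ / q₁ * (q₁ * ‖ξ.1 - ξ.2.2‖ ^ 2) := by gcongr; exact hQup _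
        _ = _ := by field_simp
    linarith
  · have hsqrt : ∀ {y w u : ℝ}, 0 < w → w * y ^ 2 ≤ u → |y| ≤ Real.sqrt u / Real.sqrt w := by
      intro y w u hw h
      rw [← Real.sqrt_div' _ hw.le]
      exact Real.abs_le_sqrt ((le_div_iff₀ hw).2 (by linarith))
    have hχ : ‖ξ.2.2 - xss‖ ≤
        Real.sqrt (S.forwardingLyapunov P kp ki uss xss ξ) / Real.sqrt w₀ := by
      rw [← abs_of_nonneg (norm_nonneg (ξ.2.2 - xss))]
      refine hsqrt hw₀ (le_trans ?_ (hW ξ).1)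
      gcongr
      exact le_add_of_nonneg_right (sq_nonneg _)
    have hη : |S.forwardingError uss xss ξ| ≤
        Real.sqrt (S.forwardingLyapunov P kp ki uss xss ξ) / Real.sqrt w₀ := by
      refine hsqrt hw₀ (le_trans ?_ (hW ξ).1)
      gcongr
      exact le_add_of_nonneg_left (sq_nonneg _)
    have he : ‖ξ.1 - ξ.2.2‖ ≤
        Real.sqrt ((ξ.1 - ξ.2.2) ⬝ᵥ (Q *ᵥ (ξ.1 - ξ.2.2))) / Real.sqrt q₀ := by
      rw [← abs_of_nonneg (norm_nonneg (ξ.1 - ξ.2.2))]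
      exact hsqrt hq₀ (hQlow _)
    have h1 := (le_abs_self _).trans (hX (ξ.2.2 - xss) (ξ.1 - ξ.2.2))
    have h2 : S.forwardingError uss xss ξ *
        ((S.C - S.M uss ᵥ* (Q⁻¹ * Y * S.D)) ⬝ᵥ (ξ.1 - ξ.2.2)) ≤
        |S.forwardingError uss xss ξ| * (c₂ * ‖ξ.1 - ξ.2.2‖) := by
      refine (le_abs_self _).trans ?_
      rw [abs_mul]
      gcongr
      exact hC _
    set sW := Real.sqrt (S.forwardingLyapunov P kp ki uss xss ξ)
    set sU := Real.sqrt ((ξ.1 - ξ.2.2) ⬝ᵥ (Q *ᵥ (ξ.1 - ξ.2.2)))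
    refine add_le_add le_rfl ?_
    calc _ ≤ kp * (c₁ * (‖ξ.2.2 - xss‖ * ‖ξ.1 - ξ.2.2‖)) +
          ki * (|S.forwardingError uss xss ξ| * (c₂ * ‖ξ.1 - ξ.2.2‖)) := by
          rw [mul_assoc ki]
          gcongr
      _ ≤ kp * (c₁ * (sW / Real.sqrt w₀ * (sU / Real.sqrt q₀))) +
          ki * (sW / Real.sqrt w₀ * (c₂ * (sU / Real.sqrt q₀))) := by gcongr
      _ = _ := by
          field_simp
  · have h1 := (hdev ξ).1
    have h2 : ‖ξ.2.2 - xss‖ ^ 2 + S.forwardingError uss xss ξ ^ 2 ≤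
        1 / w₀ * S.forwardingLyapunov P kp ki uss xss ξ := by
      rw [one_div, inv_mul_eq_div, le_div_iff₀ hw₀]
      linarith [(hW ξ).1]
    have h3 : ‖ξ.1 - ξ.2.2‖ ^ 2 ≤ 1 / q₀ * ((ξ.1 - ξ.2.2) ⬝ᵥ (Q *ᵥ (ξ.1 - ξ.2.2))) := by
      rw [one_div, inv_mul_eq_div, le_div_iff₀ hq₀]
      linarith [hQlow (ξ.1 - ξ.2.2)]
    have h4 := mul_nonneg (one_div_pos.2 hw₀).le (hQnn (ξ.1 - ξ.2.2))
    have h5 := mul_nonneg (one_div_pos.2 hq₀).le (hWnn ξ)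
    rw [mul_assoc]
    refine h1.trans (mul_le_mul_of_nonneg_left ?_ hd.le)
    linarith
  · have h1 := mul_le_mul_of_nonneg_left (hdev ξ).2 (add_pos hw₁ hq₁).le
    have h2 := hQup (ξ.1 - ξ.2.2)
    have h3 : 0 ≤ q₁ * (‖ξ.2.2 - xss‖ ^ 2 + S.forwardingError uss xss ξ ^ 2) := by positivity
    have h4 : 0 ≤ w₁ * ‖ξ.1 - ξ.2.2‖ ^ 2 := by positivity
    linarith [(hW ξ).2]

end BilinearPlant

theorem theorem2 {n p : ℕ} (S : BilinearPlant n p)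
    -- standing assumptions on the plant
    (hS : S.StandingAssumption)
    (hobs : IsObservable S.A S.D)
    -- a solution of the observer LMI
    (Q : Matrix (Fin n) (Fin n) ℝ) (Y : Matrix (Fin n) (Fin p) ℝ) (ν ε : ℝ)
    (hQ : Q.PosDef) (hν : 0 < ν) (hε : 0 < ε)
    (hLMI : (-(S.observerLMI Q Y ν ε)).PosSemidef)
    -- the reference, with a corresponding steady state
    (r uss : ℝ) (xss : Fin n → ℝ)
    (huss : uss ∈ interior S.inputRange)
    (hreg : S.RegulatorEquations r uss xss)
    -- the matrices and gains of the controller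
    (Υ P : Matrix (Fin n) (Fin n) ℝ) (hΥ : Υ.PosDef)
    (hP : (S.F uss)ᵀ * P + P * S.F uss = -((2 : ℝ) • Υ))
    (kp ki : ℝ) (hkp : 0 < kp) (hki : 0 < ki) :
    IsGloballyAsymptoticallyStable
        (S.closedLoop P (Q⁻¹ * Y) kp ki r uss xss) (xss, 0, xss) ∧
      IsLocallyExponentiallyStable
        (S.closedLoop P (Q⁻¹ * Y) kp ki r uss xss) (xss, 0, xss) := by
  have huss' : uss ∈ Ioo S.lo S.hi := by
    rwa [BilinearPlant.inputRange, interior_Icc] at huss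
  have hmem : uss ∈ S.inputRange := interior_subset huss
  have hg : S.M uss ⬝ᵥ S.g uss ≠ 0 := by
    rw [BilinearPlant.M, ← Matrix.dotProduct_mulVec]
    exact hS.2 uss hmem
  obtain ⟨D⟩ := S.nonempty_cascadeLyapunov hQ hν hε hLMI huss' hreg (hS.1 uss hmem) hg hΥ hP hkp hki
  obtain ⟨c, hc, hgrowth⟩ := S.exists_closedLoop_growth (P := P) (L := Q⁻¹ * Y) (kp := kp)
    (ki := ki) (r := r) (uss := uss) (xss := xss) (huss'.1.trans huss'.2).le
  refine D.stability ?_ S.exists_lipschitzOnWith_closedLoop hc hgrowth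
  have h1 := S.closedLoop_estimate (P := P) (L := Q⁻¹ * Y) (kp := kp) (ki := ki)
    (hS.1 uss hmem) hreg (xss, 0, xss)
  -- At the equilibrium `χ` and `z` vanish, so `φ = 0`, and the saturation fixes `uss`.
  have hv : S.inputDeviation P kp ki uss xss (xss, 0, xss) = 0 := by
    simp [BilinearPlant.inputDeviation, BilinearPlant.forwardingFeedback,
      sat_of_mem (Ioo_subset_Icc_self huss')]
  have h2 : (S.closedLoop P (Q⁻¹ * Y) kp ki r uss xss (xss, 0, xss)).2.2 = 0 := by
    rw [h1, hv]
    simp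
  have h3 := S.closedLoop_error (P := P) (L := Q⁻¹ * Y) (kp := kp) (ki := ki) (r := r)
    (uss := uss) (xss := xss) (xss, 0, xss)
  simp only [h2, sub_self, Matrix.mulVec_zero, smul_zero, add_zero, sub_zero] at h3
  exact Prod.ext h3 (Prod.ext hreg.2 h2)
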